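/- **Conventions.** Let $K$ be a commutative ring with unit. A *Lie superalgebra* over $K$ is a $K$-module $P=P_0\oplus P_1$, graded by $\mathbb Z/2$, with a bilinear bracket satisfying $[P_a,P_b]\subseteq P_{a+b}$ and $$[x,y]=-(-1)^{|x||y|}[y,x],\qquad [x,[y,z]]=[[x,y],z]+(-1)^{|x||y|}[y,[x,z]],\qquad [x_0,x_0]=0$$ for homogeneous $x,y,z$ and even $x_0$. A *graded ideal* $M$ of $P$ is a graded submodule with $[M,P]\subseteq M$; $[P,M]$ is the submodule spanned by all $[p,m]$. *Homology.* Let $\Lambda^n(P)$ be the degree $n$ part of the quotient of the tensor algebra of $P$ by the two-sided ideal generated by $x\otimes y+(-1)^{|x||y|}y\otimes x$ for homogeneous $x,y$ and by $x_0\otimes x_0$ for even $x_0$ (the latter is redundant if $2$ is invertible in $K$). $H_1(P)$ and $H_2(P)$ are the homology modules, in degrees $1$ and $2$, of $\Lambda^3(P)\xrightarrow{d_3}\Lambda^2(P)\xrightarrow{d_2}P\xrightarrow{d_1=0}K$, where, for homogeneous $x,y,z$, $d_2(x\wedge y)=-[x,y]$ and $$d_3(x\wedge y\wedge z)=-[x,y]\wedge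 z+(-1)^{|y||z|}[x,z]\wedge y-(-1)^{|x|(|y|+|z|)}[y,z]\wedge x .$$ *Exterior product.* For a graded ideal $M$ of $P$, let $P$ and $M$ act on each other by the bracket, ${}^pm=[p,m]$ and ${}^mp=[m,p]$. The non-abelian tensor product $P\otimes M$ is the Lie superalgebra generated by symbols $p\otimes m$ of degree $|p|+|m|$ ($p\in P$, $m\in M$ homogeneous) subject to: $\lambda(p\otimes m)=\lambda p\otimes m=p\otimes\lambda m$ for $\lambda\in K$; additivity in $p$ and in $m$ for summands of equal degree; and $$[p,p']\otimes m=p\otimes{}^{p'}m-(-1)^{|p||p'|}p'\otimes{}^{p}m,$$ $$p\otimes[m,m']=(-1)^{|m'|(|p|+|m|)}\,{}^{m'}p\otimes m-(-1)^{|p||m|}\,{}^{m}p\otimes m',$$ $$[p\otimes m,p'\otimes m']=-(-1)^{|p||m|}\,{}^{m}p\otimes{}^{p'}m'.$$ The non-abelian exterior product $P\wedge M$ is the quotient of $P\otimes M$ by the submodule spanned by the elements $p\otimes m+(-1)^{|p'||m'|}p'\otimes m'$ with $p,p'\in P$, $m,m'\in M$ homogeneous, $p=m'$ and $p'=m$,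 and the elements $m_0\otimes m_0$ with $m_0\in M$ even. The map $P\wedge M\to P$ is $p\wedge m\mapsto[p,m]$. **Theorem.** Let $M$ be a graded ideal of a Lie superalgebra $P$ over $K$. There is an exact sequence of even $K$-linear maps $$\operatorname{Ker}(P\wedge M\to P)\xrightarrow{f}H_2(P)\to H_2(P/M)\xrightarrow{\delta}M/[P,M]\xrightarrow{i}H_1(P)\to H_1(P/M)\to0,$$ in which $f$ sends $\sum_k p_k\wedge m_k$ to the class of the cycle $\sum_k p_k\wedge m_k\in\Lambda^2(P)$; the maps $H_j(P)\to H_j(P/M)$ are induced by the projection $P\to P/M$; $\delta$ sends the class of a cycle $\sum_k(x_k+M)\wedge(y_k+M)$ to the class of $\sum_k[x_k,y_k]\in M$; and $i$ is induced by the inclusion $M\subseteq P$. -/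

import Mathlib

open scoped TensorProduct

noncomputable section

namespace SuperLie

universe u v w w'

/-! ### Supermodules -/

/-- The sign `(-1) ^ a` for `a` in `ℤ/2`. -/
def sgn (a : ZMod 2) : ℤ := if a = 0 then 1 else -1

theorem zmod_two_cases (a : ZMod 2) : a = 0 ∨ a = 1 := by
  revert a; decide

theorem one_add_one_zmod : (1 : ZMod 2) + 1 = 0 := by decide

theorem sgn_zero : sgn 0 = 1 := by decide

theorem sgn_one : sgn 1 = -1 := by decide

/-- A supermodule: a module with a direct sum decomposition `V = V₀ ⊕ V₁`. -/
class Supermodule (K : Type u) (V : Type v) [CommRing K] [AddCommGroup V] [Module K V] where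
  deg : ZMod 2 → Submodule K V
  isCompl : IsCompl (deg 0) (deg 1)

/-- The homogeneous component `V_a` of a supermodule. -/
def deg (K : Type u) (V : Type v) [CommRing K] [AddCommGroup V] [Module K V]
    [Supermodule K V] (a : ZMod 2) : Submodule K V := Supermodule.deg a

/-- A linear map is even, for families `gV`, `gW` of homogeneous components. -/
def IsEven {K : Type u} {V : Type v} {W : Type w} [CommRing K] [AddCommGroup V] [Module K V]
    [AddCommGroup W] [Module K W] (gV : ZMod 2 → Submodule K V) (gW : ZMod 2 → Submodule K W)
    (f : V →ₗ[K] W) : Prop :=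
  ∀ a, ∀ x ∈ gV a, f x ∈ gW a

section Supermodule

variable {K : Type u} {V : Type v} [CommRing K] [AddCommGroup V] [Module K V] [Supermodule K V]

theorem isCompl_deg (a : ZMod 2) : IsCompl (deg K V a) (deg K V (a + 1)) := by
  rcases zmod_two_cases a with rfl | rfl
  · exact Supermodule.isCompl
  · exact Supermodule.isCompl.symm

/-- The projection of a supermodule onto its component of degree `a`. -/
def proj (K : Type u) {V : Type v} [CommRing K] [AddCommGroup V] [Module K V]
    [Supermodule K V] (a : ZMod 2) : V →ₗ[K] V :=
  (deg K V a).subtype ∘ₗ (deg K V a).projectionOnto (deg K V (a + 1)) (isCompl_deg a)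

theorem proj_mem (a : ZMod 2) (x : V) : proj K a x ∈ deg K V a :=
  Subtype.mem _

theorem proj_same {a : ZMod 2} {x : V} (hx : x ∈ deg K V a) : proj K a x = x := by
  have := Submodule.projectionOnto_apply_left (isCompl_deg (K := K) a) ⟨x, hx⟩
  simpa [proj] using congrArg Subtype.val this

theorem proj_other {a b : ZMod 2} (h : a ≠ b) {x : V} (hx : x ∈ deg K V b) :
    proj K a x = 0 := by
  have hb : b = a + 1 := (by decide : ∀ a b : ZMod 2, a ≠ b → b = a + 1) a b h
  subst hb
  have := Submodule.projectionOnto_apply_right (isCompl_deg (K := K) a) ⟨x, hx⟩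
  simpa [proj] using congrArg Subtype.val this

theorem exists_decomp (K : Type u) {V : Type v} [CommRing K] [AddCommGroup V] [Module K V]
    [Supermodule K V] (x : V) : ∃ y ∈ deg K V 0, ∃ z ∈ deg K V 1, y + z = x := by
  have h : x ∈ deg K V 0 ⊔ deg K V 1 := by
    have hc : IsCompl (deg K V 0) (deg K V 1) := isCompl_deg (K := K) (V := V) 0
    rw [hc.sup_eq_top]; trivial
  simpa [Submodule.mem_sup] using h

theorem proj_zero_add_proj_one (x : V) : proj K 0 x + proj K 1 x = x := by
  obtain ⟨y, hy, z, hz, rfl⟩ := exists_decomp K x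
  simp only [map_add, proj_same hy, proj_same hz, proj_other (show (0 : ZMod 2) ≠ 1 by decide) hz,
    proj_other (show (1 : ZMod 2) ≠ 0 by decide) hy]
  abel

theorem eq_zero_of_mem_deg {a b : ZMod 2} (h : a ≠ b) {x : V} (ha : x ∈ deg K V a)
    (hb : x ∈ deg K V b) : x = 0 := by
  rw [← proj_same ha, proj_other h hb]

/-- Two linear maps that agree on homogeneous elements are equal. -/
theorem linearMap_ext_deg {W : Type w} [AddCommGroup W] [Module K W] {f g : V →ₗ[K] W}
    (h : ∀ a, ∀ x ∈ deg K V a, f x = g x) : f = g := by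
  ext x
  obtain ⟨y, hy, z, hz, rfl⟩ := exists_decomp K x
  rw [map_add, map_add, h 0 y hy, h 1 z hz]

/-- A submodule is graded if it contains the homogeneous components of its elements. -/
def IsGraded (S : Submodule K V) : Prop := ∀ a, ∀ x ∈ S, proj K a x ∈ S

/-- A graded submodule is a supermodule. -/
abbrev Supermodule.ofSubmodule (S : Submodule K V) (hS : IsGraded S) : Supermodule K S where
  deg a := (SuperLie.deg K V a).comap S.subtype
  isCompl := by
    constructor
    · rw [Submodule.disjoint_def]
      intro x h0 h1
      exact Subtype.ext (eq_zero_of_mem_deg (show (0 : ZMod 2) ≠ 1 by decide) h0 h1)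
    · rw [codisjoint_iff, eq_top_iff]
      intro x _
      refine Submodule.mem_sup.2 ⟨⟨proj K 0 (x : V), hS 0 _ x.2⟩, proj_mem _ _,
        ⟨proj K 1 (x : V), hS 1 _ x.2⟩, proj_mem _ _, Subtype.ext ?_⟩
      exact proj_zero_add_proj_one (x : V)

/-- The quotient of a supermodule by a graded submodule is a supermodule. -/
abbrev Supermodule.ofQuotient (S : Submodule K V) (hS : IsGraded S) : Supermodule K (V ⧸ S) where
  deg a := (SuperLie.deg K V a).map S.mkQ
  isCompl := by
    constructor
    · rw [Submodule.disjoint_def]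
      rintro _ ⟨x, hx, rfl⟩ ⟨y, hy, hxy⟩
      have h : y - x ∈ S := (Submodule.Quotient.eq S).1 hxy
      have h' := hS 0 _ h
      rw [map_sub, proj_same hx, proj_other (show (0 : ZMod 2) ≠ 1 by decide) hy, zero_sub] at h'
      exact (Submodule.Quotient.mk_eq_zero S).2 (by simpa using S.neg_mem h')
    · rw [codisjoint_iff, eq_top_iff]
      intro x _
      obtain ⟨x, rfl⟩ := S.mkQ_surjective x
      refine Submodule.mem_sup.2 ⟨S.mkQ (proj K 0 x), ⟨_, proj_mem _ _, rfl⟩,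
        S.mkQ (proj K 1 x), ⟨_, proj_mem _ _, rfl⟩, ?_⟩
      rw [← map_add, proj_zero_add_proj_one]

end Supermodule

/-! ### Lie superalgebras, ideals, homomorphisms -/

/-- A Lie superalgebra over a commutative ring. -/
class LieSuperalgebra (K : Type u) (P : Type v) [CommRing K] [AddCommGroup P] [Module K P]
    extends Supermodule K P where
  brk : P →ₗ[K] P →ₗ[K] P
  brk_mem : ∀ {a b : ZMod 2} {x y : P}, x ∈ SuperLie.deg K P a → y ∈ SuperLie.deg K P b →
    brk x y ∈ SuperLie.deg K P (a + b)
  skew : ∀ {a b : ZMod 2} {x y : P}, x ∈ SuperLie.deg K P a → y ∈ SuperLie.deg K P b →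
    brk x y = -(sgn (a * b) • brk y x)
  jacobi : ∀ {a b c : ZMod 2} {x y z : P}, x ∈ SuperLie.deg K P a → y ∈ SuperLie.deg K P b →
    z ∈ SuperLie.deg K P c →
    brk x (brk y z) = brk (brk x y) z + sgn (a * b) • brk y (brk x z)
  brk_self : ∀ {x : P}, x ∈ SuperLie.deg K P 0 → brk x x = 0

/-- The bracket `[x, y]` of a Lie superalgebra. -/
def brk (K : Type u) {P : Type v} [CommRing K] [AddCommGroup P] [Module K P]
    [LieSuperalgebra K P] : P →ₗ[K] P →ₗ[K] P := LieSuperalgebra.brk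

section Lie

variable {K : Type u} {P : Type v} [CommRing K] [AddCommGroup P] [Module K P]
  [LieSuperalgebra K P]

theorem brk_mem {a b : ZMod 2} {x y : P} (hx : x ∈ deg K P a) (hy : y ∈ deg K P b) :
    brk K x y ∈ deg K P (a + b) := LieSuperalgebra.brk_mem hx hy

theorem skew {a b : ZMod 2} {x y : P} (hx : x ∈ deg K P a) (hy : y ∈ deg K P b) :
    brk K x y = -(sgn (a * b) • brk K y x) := LieSuperalgebra.skew hx hy

theorem jacobi {a b c : ZMod 2} {x y z : P} (hx : x ∈ deg K P a) (hy : y ∈ deg K P b)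
    (hz : z ∈ deg K P c) :
    brk K x (brk K y z) = brk K (brk K x y) z + sgn (a * b) • brk K y (brk K x z) :=
  LieSuperalgebra.jacobi hx hy hz

theorem brk_self {x : P} (hx : x ∈ deg K P 0) : brk K x x = 0 := LieSuperalgebra.brk_self hx

variable (K P) in
/-- A graded ideal of a Lie superalgebra: a graded submodule `M` with `[M, P] ⊆ M`. -/
structure GradedIdeal extends Submodule K P where
  graded : IsGraded toSubmodule
  brk_mem_right : ∀ m ∈ toSubmodule, ∀ p : P, brk K m p ∈ toSubmodule

theorem GradedIdeal.brk_mem_left (M : GradedIdeal K P) (p : P) {m : P} (hm : m ∈ M.toSubmodule) :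
    brk K p m ∈ M.toSubmodule := by
  have key : ∀ a b : ZMod 2, brk K (proj K a p) (proj K b m) ∈ M.toSubmodule := by
    intro a b
    rw [skew (proj_mem a p) (proj_mem b m)]
    exact neg_mem (zsmul_mem (M.brk_mem_right _ (M.graded b m hm) _) _)
  rw [← proj_zero_add_proj_one (K := K) p, ← proj_zero_add_proj_one (K := K) m]
  simp only [map_add, LinearMap.add_apply]
  exact add_mem (add_mem (key _ _) (key _ _)) (add_mem (key _ _) (key _ _))

/-- The submodule `[S, T]` spanned by all `[s, t]`, `s ∈ S`, `t ∈ T`. -/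
def brkSpan (S T : Submodule K P) : Submodule K P :=
  Submodule.span K {x | ∃ s ∈ S, ∃ t ∈ T, x = brk K s t}

instance GradedIdeal.supermodule (M : GradedIdeal K P) : Supermodule K M.toSubmodule :=
  Supermodule.ofSubmodule M.toSubmodule M.graded

theorem GradedIdeal.mem_deg (M : GradedIdeal K P) {a : ZMod 2} {x : M.toSubmodule} :
    x ∈ deg K M.toSubmodule a ↔ (x : P) ∈ deg K P a := Iff.rfl

/-- A graded ideal is a Lie superalgebra. -/
instance GradedIdeal.lieSuperalgebra (M : GradedIdeal K P) :
    LieSuperalgebra K M.toSubmodule where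
  toSupermodule := M.supermodule
  brk := LinearMap.mk₂ K (fun x y => ⟨brk K (x : P) (y : P), M.brk_mem_right _ x.2 _⟩)
    (fun x y z => Subtype.ext (by simp)) (fun c x y => Subtype.ext (by simp))
    (fun x y z => Subtype.ext (by simp)) (fun c x y => Subtype.ext (by simp))
  brk_mem := fun hx hy => M.mem_deg.2 (brk_mem (M.mem_deg.1 hx) (M.mem_deg.1 hy))
  skew := fun hx hy => Subtype.ext (skew (K := K) (M.mem_deg.1 hx) (M.mem_deg.1 hy))
  jacobi := fun hx hy hz => Subtype.ext
    (jacobi (K := K) (M.mem_deg.1 hx) (M.mem_deg.1 hy) (M.mem_deg.1 hz))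
  brk_self := fun hx => Subtype.ext (brk_self (K := K) (M.mem_deg.1 hx))

theorem GradedIdeal.coe_brk (M : GradedIdeal K P) (x y : M.toSubmodule) :
    ((brk K x y : M.toSubmodule) : P) = brk K (x : P) (y : P) := rfl

/-- The quotient `P / M` of a Lie superalgebra by a graded ideal. -/
abbrev GradedIdeal.Quot (M : GradedIdeal K P) : Type v := P ⧸ M.toSubmodule

instance GradedIdeal.quotSupermodule (M : GradedIdeal K P) : Supermodule K M.Quot :=
  Supermodule.ofQuotient M.toSubmodule M.graded

theorem GradedIdeal.mem_deg_quot (M : GradedIdeal K P) {a : ZMod 2} {q : M.Quot} :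
    q ∈ deg K M.Quot a ↔ ∃ x ∈ deg K P a, M.toSubmodule.mkQ x = q := Iff.rfl

/-- The quotient of a Lie superalgebra by a graded ideal is a Lie superalgebra. -/
instance GradedIdeal.quotLieSuperalgebra (M : GradedIdeal K P) :
    LieSuperalgebra K M.Quot where
  toSupermodule := M.quotSupermodule
  brk := M.toSubmodule.liftQ
    (LinearMap.flip (M.toSubmodule.liftQ
      (LinearMap.flip ((brk K (P := P)).compr₂ M.toSubmodule.mkQ)) (by
        intro m hm
        ext p
        exact (Submodule.Quotient.mk_eq_zero _).2 (M.brk_mem_left p hm)))) (by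
    intro m hm
    ext p
    exact (Submodule.Quotient.mk_eq_zero _).2 (M.brk_mem_right m hm p))
  brk_mem := fun hx hy => by
    obtain ⟨x, hx', rfl⟩ := M.mem_deg_quot.1 hx
    obtain ⟨y, hy', rfl⟩ := M.mem_deg_quot.1 hy
    exact M.mem_deg_quot.2 ⟨brk K x y, brk_mem hx' hy', rfl⟩
  skew := fun hx hy => by
    obtain ⟨x, hx', rfl⟩ := M.mem_deg_quot.1 hx
    obtain ⟨y, hy', rfl⟩ := M.mem_deg_quot.1 hy
    exact congrArg M.toSubmodule.mkQ (skew (K := K) hx' hy')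
  jacobi := fun hx hy hz => by
    obtain ⟨x, hx', rfl⟩ := M.mem_deg_quot.1 hx
    obtain ⟨y, hy', rfl⟩ := M.mem_deg_quot.1 hy
    obtain ⟨z, hz', rfl⟩ := M.mem_deg_quot.1 hz
    exact congrArg M.toSubmodule.mkQ (jacobi (K := K) hx' hy' hz')
  brk_self := fun hx => by
    obtain ⟨x, hx', rfl⟩ := M.mem_deg_quot.1 hx
    exact congrArg M.toSubmodule.mkQ (brk_self (K := K) hx')

variable (K P) in
/-- A homomorphism of Lie superalgebras: an even linear map that preserves the bracket. -/
structure LieSuperHom (Q : Type w) [AddCommGroup Q] [Module K Q] [LieSuperalgebra K Q]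
    extends P →ₗ[K] Q where
  map_deg : IsEven (deg K P) (deg K Q) toLinearMap
  map_brk : ∀ x y : P, toLinearMap (brk K x y) = brk K (toLinearMap x) (toLinearMap y)

/-- The projection `P → P / M`. -/
def GradedIdeal.mkHom (M : GradedIdeal K P) : LieSuperHom K P M.Quot where
  toLinearMap := M.toSubmodule.mkQ
  map_deg := fun _ x hx => M.mem_deg_quot.2 ⟨x, hx, rfl⟩
  map_brk := fun _ _ => rfl

end Lie

/-! ### Low-dimensional homology with trivial coefficients -/

section Homology

variable (K : Type u) (P : Type v) [CommRing K] [AddCommGroup P] [Module K P]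

section Exterior

variable [Supermodule K P]

/-- The relations of the Grassmann algebra in degree two: `x ⊗ y + (-1)^(|x||y|) y ⊗ x` for
homogeneous `x`, `y`, and `x ⊗ x` for even `x` (which is redundant if `2` is invertible). -/
def wedgeRel₂ : Submodule K (P ⊗[K] P) :=
  Submodule.span K
    ({t | ∃ (a b : ZMod 2) (x y : P), x ∈ deg K P a ∧ y ∈ deg K P b ∧
        t = x ⊗ₜ[K] y + sgn (a * b) • y ⊗ₜ[K] x} ∪
      {t | ∃ x ∈ deg K P 0, t = x ⊗ₜ[K] x})

/-- The super exterior square `Λ²(P)` over `K`. -/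
abbrev Wedge₂ : Type v := (P ⊗[K] P) ⧸ wedgeRel₂ K P

/-- The degree three part `R ⊗ P + P ⊗ R` of the ideal that the relations `R` in degree two
generate in the tensor algebra. -/
def wedgeRel₃ : Submodule K ((P ⊗[K] P) ⊗[K] P) :=
  Submodule.span K
    ({t | ∃ r ∈ wedgeRel₂ K P, ∃ z : P, t = r ⊗ₜ[K] z} ∪
      {t | ∃ r ∈ wedgeRel₂ K P, ∃ z : P, t = (TensorProduct.assoc K P P P).symm (z ⊗ₜ[K] r)})

/-- The super exterior cube `Λ³(P)` over `K`. -/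
abbrev Wedge₃ : Type v := ((P ⊗[K] P) ⊗[K] P) ⧸ wedgeRel₃ K P

variable {P} in
/-- The element `x ∧ y` of `Λ²(P)`. -/
def wedge₂ (x y : P) : Wedge₂ K P := (wedgeRel₂ K P).mkQ (x ⊗ₜ[K] y)

variable {P} in
/-- The element `x ∧ y ∧ z` of `Λ³(P)`. -/
def wedge₃ (x y z : P) : Wedge₃ K P := (wedgeRel₃ K P).mkQ ((x ⊗ₜ[K] y) ⊗ₜ[K] z)

/-- The grading of `Λ²(P)` that is induced by the one of `P`. -/
def wedge₂Deg (c : ZMod 2) : Submodule K (Wedge₂ K P) :=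
  Submodule.span K {t | ∃ (a b : ZMod 2) (x y : P), x ∈ deg K P a ∧ y ∈ deg K P b ∧ a + b = c ∧
    t = wedge₂ K x y}

/-- The braiding `x ⊗ y ↦ (-1)^(|x||y|) y ⊗ x`. -/
def braid : P ⊗[K] P →ₗ[K] P ⊗[K] P :=
  ∑ a : ZMod 2, ∑ b : ZMod 2, sgn (a * b) •
    ((TensorProduct.map (proj K b) (proj K a)) ∘ₗ (TensorProduct.comm K P P).toLinearMap)

variable {K P}

theorem braid_tmul {a b : ZMod 2} {x y : P} (hx : x ∈ deg K P a) (hy : y ∈ deg K P b) :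
    braid K P (x ⊗ₜ[K] y) = sgn (a * b) • y ⊗ₜ[K] x := by
  have hs : (Finset.univ : Finset (ZMod 2)) = {0, 1} := by decide
  have h01 : (0 : ZMod 2) ≠ 1 := by decide
  have h10 : (1 : ZMod 2) ≠ 0 := by decide
  rcases zmod_two_cases a with rfl | rfl <;> rcases zmod_two_cases b with rfl | rfl <;>
    simp [braid, hs, h01, proj_same hx, proj_same hy, proj_other h01, proj_other h10, hx, hy]

theorem wedge₂_neg_left (x y : P) : wedge₂ K (-x) y = -wedge₂ K x y := by
  simp [wedge₂, TensorProduct.neg_tmul]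

theorem wedge₂_zsmul_left (n : ℤ) (x y : P) : wedge₂ K (n • x) y = n • wedge₂ K x y := by
  simp [wedge₂, ← TensorProduct.smul_tmul']

theorem wedge₂_zero_left (y : P) : wedge₂ K 0 y = 0 := by
  simp [wedge₂]

theorem wedge₂_swap {a b : ZMod 2} {x y : P} (hx : x ∈ deg K P a) (hy : y ∈ deg K P b) :
    wedge₂ K x y = -(sgn (a * b) • wedge₂ K y x) := by
  rw [eq_neg_iff_add_eq_zero]
  have : (wedgeRel₂ K P).mkQ (x ⊗ₜ[K] y + sgn (a * b) • y ⊗ₜ[K] x) = 0 :=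
    (Submodule.Quotient.mk_eq_zero _).2
      (Submodule.subset_span (Or.inl ⟨a, b, x, y, hx, hy, rfl⟩))
  simpa [wedge₂] using this

theorem wedge₂_self {x : P} (hx : x ∈ deg K P 0) : wedge₂ K x x = 0 :=
  (Submodule.Quotient.mk_eq_zero _).2 (Submodule.subset_span (Or.inr ⟨x, hx, rfl⟩))

end Exterior

variable [LieSuperalgebra K P]

/-- The boundary map `d₂ : Λ²(P) → P`, `x ∧ y ↦ -[x, y]`. -/
def d₂ : Wedge₂ K P →ₗ[K] P :=
  (wedgeRel₂ K P).liftQ (-TensorProduct.lift (brk K)) (by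
    refine Submodule.span_le.2 ?_
    rintro _ (⟨a, b, x, y, hx, hy, rfl⟩ | ⟨x, hx, rfl⟩)
    · simp [skew hx hy]
    · simp [brk_self hx])

/-- The map on tensors that induces `d₃`. -/
def d₃Aux : (P ⊗[K] P) ⊗[K] P →ₗ[K] Wedge₂ K P :=
  (wedgeRel₂ K P).mkQ ∘ₗ
    (-(TensorProduct.lift (brk K)).rTensor P
      + (TensorProduct.lift (brk K)).rTensor P ∘ₗ (TensorProduct.assoc K P P P).symm.toLinearMap ∘ₗ
          (braid K P).lTensor P ∘ₗ (TensorProduct.assoc K P P P).toLinearMap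
      - braid K P ∘ₗ (TensorProduct.lift (brk K)).lTensor P ∘ₗ
          (TensorProduct.assoc K P P P).toLinearMap)

variable {K P}

theorem d₂_wedge₂ (x y : P) : d₂ K P (wedge₂ K x y) = -brk K x y := by
  exact (Submodule.liftQ_apply _ _ _).trans (by simp)

theorem d₃Aux_tmul {a b c : ZMod 2} {x y z : P} (hx : x ∈ deg K P a) (hy : y ∈ deg K P b)
    (hz : z ∈ deg K P c) :
    d₃Aux K P ((x ⊗ₜ[K] y) ⊗ₜ[K] z) =
      -wedge₂ K (brk K x y) z + sgn (b * c) • wedge₂ K (brk K x z) y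
        - sgn (a * (b + c)) • wedge₂ K (brk K y z) x := by
  simp [d₃Aux, wedge₂, braid_tmul hy hz, braid_tmul hx (brk_mem hy hz)]

variable (K P)

theorem d₃Aux_rel_tmul {r : P ⊗[K] P} (hr : r ∈ wedgeRel₂ K P) (z : P) :
    d₃Aux K P (r ⊗ₜ[K] z) = 0 := by
  have key : ∀ c, ∀ z ∈ deg K P c, wedgeRel₂ K P ≤
      LinearMap.ker (d₃Aux K P ∘ₗ (TensorProduct.mk K (P ⊗[K] P) P).flip z) := by
    intro c z hz
    refine Submodule.span_le.2 ?_
    rintro _ (⟨a, b, x, y, hx, hy, rfl⟩ | ⟨x, hx, rfl⟩)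
    · simp only [SetLike.mem_coe, LinearMap.mem_ker, LinearMap.comp_apply, LinearMap.flip_apply,
        TensorProduct.mk_apply, map_add, map_zsmul, d₃Aux_tmul hx hy hz, d₃Aux_tmul hy hx hz,
        skew hx hy, wedge₂_neg_left, wedge₂_zsmul_left]
      rcases zmod_two_cases a with rfl | rfl <;> rcases zmod_two_cases b with rfl | rfl <;>
        rcases zmod_two_cases c with rfl | rfl <;> simp [sgn_zero, sgn_one, one_add_one_zmod] <;> abel
    · simp [d₃Aux_tmul hx hx hz, brk_self hx, wedge₂_zero_left]
  obtain ⟨z₀, h₀, z₁, h₁, rfl⟩ := exists_decomp K z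
  have e₀ := key 0 z₀ h₀ hr
  have e₁ := key 1 z₁ h₁ hr
  simp only [LinearMap.mem_ker, LinearMap.comp_apply, LinearMap.flip_apply,
    TensorProduct.mk_apply] at e₀ e₁
  rw [TensorProduct.tmul_add, map_add, e₀, e₁, add_zero]

theorem d₃Aux_tmul_rel {r : P ⊗[K] P} (hr : r ∈ wedgeRel₂ K P) (z : P) :
    d₃Aux K P ((TensorProduct.assoc K P P P).symm (z ⊗ₜ[K] r)) = 0 := by
  have key : ∀ c, ∀ z ∈ deg K P c, wedgeRel₂ K P ≤
      LinearMap.ker (d₃Aux K P ∘ₗ (TensorProduct.assoc K P P P).symm.toLinearMap ∘ₗ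
        TensorProduct.mk K P (P ⊗[K] P) z) := by
    intro c z hz
    refine Submodule.span_le.2 ?_
    rintro _ (⟨a, b, x, y, hx, hy, rfl⟩ | ⟨x, hx, rfl⟩)
    · simp only [SetLike.mem_coe, LinearMap.mem_ker, LinearMap.comp_apply, LinearEquiv.coe_coe,
        TensorProduct.mk_apply, map_add, map_zsmul,
        TensorProduct.assoc_symm_tmul, d₃Aux_tmul hz hx hy, d₃Aux_tmul hz hy hx,
        skew hx hy, wedge₂_neg_left, wedge₂_zsmul_left]
      rcases zmod_two_cases a with rfl | rfl <;> rcases zmod_two_cases b with rfl | rfl <;>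
        rcases zmod_two_cases c with rfl | rfl <;> simp [sgn_zero, sgn_one, one_add_one_zmod] <;> abel
    · simp [d₃Aux_tmul hz hx hx, brk_self hx, wedge₂_zero_left, sgn_zero]
  obtain ⟨z₀, h₀, z₁, h₁, rfl⟩ := exists_decomp K z
  have e₀ := key 0 z₀ h₀ hr
  have e₁ := key 1 z₁ h₁ hr
  simp only [LinearMap.mem_ker, LinearMap.comp_apply, LinearEquiv.coe_coe,
    TensorProduct.mk_apply] at e₀ e₁
  rw [TensorProduct.add_tmul, map_add, map_add, e₀, e₁, add_zero]

theorem wedgeRel₃_le_ker : wedgeRel₃ K P ≤ LinearMap.ker (d₃Aux K P) := by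
  refine Submodule.span_le.2 ?_
  rintro _ (⟨r, hr, z, rfl⟩ | ⟨r, hr, z, rfl⟩)
  · exact d₃Aux_rel_tmul K P hr z
  · exact d₃Aux_tmul_rel K P hr z

/-- The boundary map `d₃ : Λ³(P) → Λ²(P)`; for homogeneous `x`, `y`, `z` it sends `x ∧ y ∧ z` to
`-[x, y] ∧ z + (-1)^(|y||z|) [x, z] ∧ y - (-1)^(|x|(|y|+|z|)) [y, z] ∧ x`. -/
def d₃ : Wedge₃ K P →ₗ[K] Wedge₂ K P :=
  (wedgeRel₃ K P).liftQ (d₃Aux K P) (wedgeRel₃_le_ker K P)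

theorem d₃_wedge₃ {a b c : ZMod 2} {x y z : P} (hx : x ∈ deg K P a) (hy : y ∈ deg K P b)
    (hz : z ∈ deg K P c) :
    d₃ K P (wedge₃ K x y z) =
      -wedge₂ K (brk K x y) z + sgn (b * c) • wedge₂ K (brk K x z) y
        - sgn (a * (b + c)) • wedge₂ K (brk K y z) x :=
  d₃Aux_tmul hx hy hz

/-- The boundary map `d₁ : P → K`, `x ↦ -(x · 1)`. It is zero since `P` acts trivially on `K`. -/
def d₁ : P →ₗ[K] K := 0

end Homology

/-- The homology `Ker g / Im f` at the middle term of `A → B → C`. -/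
abbrev HomologyAt {K : Type u} {A : Type v} {B : Type w} {C : Type w'} [CommRing K]
    [AddCommGroup A] [Module K A] [AddCommGroup B] [Module K B] [AddCommGroup C] [Module K C]
    (f : A →ₗ[K] B) (g : B →ₗ[K] C) : Type w :=
  LinearMap.ker g ⧸ (LinearMap.range f).submoduleOf (LinearMap.ker g)

section Homology

variable (K : Type u) (P : Type v) [CommRing K] [AddCommGroup P] [Module K P]
  [LieSuperalgebra K P]

/-- The first homology `H₁(P) = Ker d₁ / Im d₂`. -/
abbrev H₁ : Type v := HomologyAt (d₂ K P) (d₁ K P)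

/-- The second homology `H₂(P) = Ker d₂ / Im d₃`. -/
abbrev H₂ : Type v := HomologyAt (d₃ K P) (d₂ K P)

variable {P} in
/-- The class in `H₁(P)` of an element of `P` (every element is a cycle). -/
def H₁.mk (x : P) : H₁ K P := Submodule.Quotient.mk ⟨x, rfl⟩

variable {P} in
/-- The class in `H₂(P)` of a cycle. -/
def H₂.mk (z : Wedge₂ K P) (hz : z ∈ LinearMap.ker (d₂ K P)) : H₂ K P :=
  Submodule.Quotient.mk ⟨z, hz⟩

/-- The grading of `H₁(P)`. -/
def H₁.deg (a : ZMod 2) : Submodule K (H₁ K P) :=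
  ((SuperLie.deg K P a).comap (LinearMap.ker (d₁ K P)).subtype).map (Submodule.mkQ _)

/-- The grading of `H₂(P)`. -/
def H₂.deg (a : ZMod 2) : Submodule K (H₂ K P) :=
  ((wedge₂Deg K P a).comap (LinearMap.ker (d₂ K P)).subtype).map (Submodule.mkQ _)

variable {K P} {Q : Type w} [AddCommGroup Q] [Module K Q] [LieSuperalgebra K Q]

theorem wedgeRel₂_le_comap (f : LieSuperHom K P Q) :
    wedgeRel₂ K P ≤ (wedgeRel₂ K Q).comap (TensorProduct.map f.toLinearMap f.toLinearMap) := by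
  refine Submodule.span_le.2 ?_
  rintro _ (⟨a, b, x, y, hx, hy, rfl⟩ | ⟨x, hx, rfl⟩)
  · exact Submodule.subset_span (Or.inl ⟨a, b, f.toLinearMap x, f.toLinearMap y,
      f.map_deg a x hx, f.map_deg b y hy, by simp⟩)
  · exact Submodule.subset_span (Or.inr ⟨f.toLinearMap x, f.map_deg 0 x hx, by simp⟩)

/-- The map `Λ²(P) → Λ²(Q)`, `x ∧ y ↦ f x ∧ f y`, induced by a homomorphism `f : P → Q`. -/
def wedge₂Map (f : LieSuperHom K P Q) : Wedge₂ K P →ₗ[K] Wedge₂ K Q :=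
  (wedgeRel₂ K P).mapQ (wedgeRel₂ K Q) (TensorProduct.map f.toLinearMap f.toLinearMap)
    (wedgeRel₂_le_comap f)

theorem wedge₂Map_wedge₂ (f : LieSuperHom K P Q) (x y : P) :
    wedge₂Map f (wedge₂ K x y) = wedge₂ K (f.toLinearMap x) (f.toLinearMap y) := rfl

theorem d₂_wedge₂Map (f : LieSuperHom K P Q) (z : Wedge₂ K P) :
    d₂ K Q (wedge₂Map f z) = f.toLinearMap (d₂ K P z) := by
  obtain ⟨t, rfl⟩ := (wedgeRel₂ K P).mkQ_surjective z
  induction t using TensorProduct.induction_on with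
  | zero => simp
  | tmul x y =>
    change d₂ K Q (wedge₂Map f (wedge₂ K x y)) = f.toLinearMap (d₂ K P (wedge₂ K x y))
    rw [wedge₂Map_wedge₂, d₂_wedge₂, d₂_wedge₂, map_neg, f.map_brk]
  | add s t hs ht => simp only [map_add, hs, ht]

theorem wedge₃_induction {p : Wedge₃ K P → Prop} (hadd : ∀ s t, p s → p t → p (s + t))
    (h0 : p 0)
    (h : ∀ (a b c : ZMod 2) (x y z : P), x ∈ deg K P a → y ∈ deg K P b → z ∈ deg K P c →
      p (wedge₃ K x y z)) (t : Wedge₃ K P) : p t := by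
  obtain ⟨t, rfl⟩ := (wedgeRel₃ K P).mkQ_surjective t
  induction t using TensorProduct.induction_on with
  | zero => simpa using h0
  | add s t hs ht => rw [map_add]; exact hadd _ _ hs ht
  | tmul r z =>
    induction r using TensorProduct.induction_on with
    | zero => simpa using h0
    | add s t hs ht => rw [TensorProduct.add_tmul, map_add]; exact hadd _ _ hs ht
    | tmul x y =>
      obtain ⟨x₀, hx₀, x₁, hx₁, rfl⟩ := exists_decomp K x
      obtain ⟨y₀, hy₀, y₁, hy₁, rfl⟩ := exists_decomp K y
      obtain ⟨z₀, hz₀, z₁, hz₁, rfl⟩ := exists_decomp K z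
      simp only [TensorProduct.add_tmul, TensorProduct.tmul_add, map_add]
      exact hadd _ _
        (hadd _ _
          (hadd _ _ (h _ _ _ _ _ _ hx₀ hy₀ hz₀) (h _ _ _ _ _ _ hx₁ hy₀ hz₀))
          (hadd _ _ (h _ _ _ _ _ _ hx₀ hy₁ hz₀) (h _ _ _ _ _ _ hx₁ hy₁ hz₀)))
        (hadd _ _
          (hadd _ _ (h _ _ _ _ _ _ hx₀ hy₀ hz₁) (h _ _ _ _ _ _ hx₁ hy₀ hz₁))
          (hadd _ _ (h _ _ _ _ _ _ hx₀ hy₁ hz₁) (h _ _ _ _ _ _ hx₁ hy₁ hz₁)))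

theorem d₂_d₃ (t : Wedge₃ K P) : d₂ K P (d₃ K P t) = 0 := by
  induction t using wedge₃_induction with
  | hadd s t hs ht => rw [map_add, map_add, hs, ht, add_zero]
  | h0 => simp
  | h a b c x y z hx hy hz =>
    rw [d₃_wedge₃ K P hx hy hz]
    simp only [map_add, map_sub, map_neg, map_zsmul, d₂_wedge₂, smul_neg, neg_neg]
    rw [skew hx (brk_mem hy hz) |> fun h => (by
      rw [h]
      rcases zmod_two_cases (a * (b + c)) with h' | h' <;> simp [h', sgn_zero, sgn_one] :
        sgn (a * (b + c)) • brk K (brk K y z) x = -brk K x (brk K y z)),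
      jacobi hx hy hz, skew hy (brk_mem hx hz)]
    rcases zmod_two_cases a with rfl | rfl <;> rcases zmod_two_cases b with rfl | rfl <;>
      rcases zmod_two_cases c with rfl | rfl <;> simp [sgn_zero, sgn_one, one_add_one_zmod]

theorem d₁_d₂ (t : Wedge₂ K P) : d₁ K P (d₂ K P t) = 0 := rfl

theorem wedge₂Map_d₃_mem (f : LieSuperHom K P Q) (t : Wedge₃ K P) :
    wedge₂Map f (d₃ K P t) ∈ LinearMap.range (d₃ K Q) := by
  induction t using wedge₃_induction with
  | hadd s t hs ht => rw [map_add, map_add]; exact add_mem hs ht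
  | h0 => simp
  | h a b c x y z hx hy hz =>
    refine ⟨wedge₃ K (f.toLinearMap x) (f.toLinearMap y) (f.toLinearMap z), ?_⟩
    rw [d₃_wedge₃ K P hx hy hz,
      d₃_wedge₃ K Q (f.map_deg a x hx) (f.map_deg b y hy) (f.map_deg c z hz)]
    simp only [map_add, map_sub, map_neg, map_zsmul, wedge₂Map_wedge₂, f.map_brk]

/-- The map `H₁(P) → H₁(Q)` induced by a homomorphism `P → Q`. -/
def H₁.map (f : LieSuperHom K P Q) : H₁ K P →ₗ[K] H₁ K Q :=
  Submodule.mapQ _ _ (f.toLinearMap.restrict (p := LinearMap.ker (d₁ K P))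
    (q := LinearMap.ker (d₁ K Q)) (fun _ _ => rfl)) (by
    rintro ⟨_, _⟩ ⟨z, rfl⟩
    exact ⟨wedge₂Map f z, d₂_wedge₂Map f z⟩)

/-- The map `H₂(P) → H₂(Q)` induced by a homomorphism `P → Q`. -/
def H₂.map (f : LieSuperHom K P Q) : H₂ K P →ₗ[K] H₂ K Q :=
  Submodule.mapQ _ _ ((wedge₂Map f).restrict (p := LinearMap.ker (d₂ K P))
    (q := LinearMap.ker (d₂ K Q)) (fun z hz => by
      rw [LinearMap.mem_ker] at hz ⊢
      rw [d₂_wedge₂Map, hz, map_zero])) (by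
    rintro ⟨_, _⟩ ⟨t, rfl⟩
    exact wedge₂Map_d₃_mem f t)

end Homology

/-! ### Actions and crossed modules -/

/-- An action of a Lie superalgebra `P` on a Lie superalgebra `M`. -/
structure LieSuperAction (K : Type u) (P : Type v) (M : Type w) [CommRing K]
    [AddCommGroup P] [Module K P] [LieSuperalgebra K P]
    [AddCommGroup M] [Module K M] [LieSuperalgebra K M] where
  act : P →ₗ[K] M →ₗ[K] M
  act_mem : ∀ {a b : ZMod 2} {p : P} {m : M}, p ∈ deg K P a → m ∈ deg K M b →
    act p m ∈ deg K M (a + b)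
  brk_act : ∀ {a b c : ZMod 2} {p q : P} {m : M}, p ∈ deg K P a → q ∈ deg K P b →
    m ∈ deg K M c → act (brk K p q) m = act p (act q m) - sgn (a * b) • act q (act p m)
  act_brk : ∀ {a b c : ZMod 2} {p : P} {m n : M}, p ∈ deg K P a → m ∈ deg K M b →
    n ∈ deg K M c → act p (brk K m n) = brk K (act p m) n + sgn (a * b) • brk K m (act p n)

/-- A crossed `P`-module `bd : M → P`. -/
structure CrossedModule (K : Type u) (P : Type v) (M : Type w) [CommRing K]
    [AddCommGroup P] [Module K P] [LieSuperalgebra K P]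
    [AddCommGroup M] [Module K M] [LieSuperalgebra K M] extends LieSuperAction K P M where
  bd : LieSuperHom K M P
  bd_act : ∀ (p : P) (m : M), bd.toLinearMap (act p m) = brk K p (bd.toLinearMap m)
  act_bd : ∀ m n : M, act (bd.toLinearMap m) n = brk K m n

section Crossed

variable {K : Type u} {P : Type v} {M : Type w} {N : Type w'} [CommRing K]
  [AddCommGroup P] [Module K P] [LieSuperalgebra K P]
  [AddCommGroup M] [Module K M] [LieSuperalgebra K M]
  [AddCommGroup N] [Module K N] [LieSuperalgebra K N]

/-- The action of `M` on `N` via `P`, for crossed `P`-modules `M` and `N`. -/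
def CrossedModule.actionOn (C : CrossedModule K P M) (D : CrossedModule K P N) :
    LieSuperAction K M N where
  act := D.act ∘ₗ C.bd.toLinearMap
  act_mem := fun hp hm => D.act_mem (C.bd.map_deg _ _ hp) hm
  brk_act := fun hp hq hm => by
    simp only [LinearMap.comp_apply, C.bd.map_brk]
    exact D.brk_act (C.bd.map_deg _ _ hp) (C.bd.map_deg _ _ hq) hm
  act_brk := fun hp hm hn => D.act_brk (C.bd.map_deg _ _ hp) hm hn

theorem CrossedModule.actionOn_act (C : CrossedModule K P M) (D : CrossedModule K P N) (m : M)
    (n : N) : (C.actionOn D).act m n = D.act (C.bd.toLinearMap m) n := rfl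

variable (K P) in
/-- The crossed `P`-module `id : P → P`. -/
def CrossedModule.self : CrossedModule K P P where
  act := brk K
  act_mem := brk_mem
  brk_act := fun hp hq hm => by rw [jacobi hp hq hm]; abel
  act_brk := jacobi
  bd := { toLinearMap := LinearMap.id, map_deg := fun _ _ h => h, map_brk := fun _ _ => rfl }
  bd_act := fun _ _ => rfl
  act_bd := fun _ _ => rfl

/-- The crossed `P`-module given by the inclusion of a graded ideal of `P`. -/
def CrossedModule.ofIdeal (M : GradedIdeal K P) : CrossedModule K P M.toSubmodule where
  act := LinearMap.mk₂ K (fun p m => ⟨brk K p (m : P), M.brk_mem_left p m.2⟩)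
    (fun x y z => Subtype.ext (by simp)) (fun c x y => Subtype.ext (by simp))
    (fun x y z => Subtype.ext (by simp)) (fun c x y => Subtype.ext (by simp))
  act_mem := fun hp hm => M.mem_deg.2 (brk_mem hp (M.mem_deg.1 hm))
  brk_act := fun hp hq hm => Subtype.ext (by
    have := jacobi hp hq (M.mem_deg.1 hm)
    exact eq_sub_of_add_eq this.symm)
  act_brk := fun hp hm hn => Subtype.ext (jacobi hp (M.mem_deg.1 hm) (M.mem_deg.1 hn))
  bd := { toLinearMap := M.toSubmodule.subtype
          map_deg := fun _ _ h => M.mem_deg.1 h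
          map_brk := fun _ _ => rfl }
  bd_act := fun _ _ => rfl
  act_bd := fun _ _ => rfl

end Crossed

/-! ### The non-abelian tensor product -/

section Free

variable (K : Type u) (M : Type v) (N : Type w) [CommRing K]
  [AddCommGroup M] [Module K M] [Supermodule K M]
  [AddCommGroup N] [Module K N] [Supermodule K N]

/-- The graded set of symbols `m ⊗ n` with `m`, `n` homogeneous of degrees `a`, `b`. -/
structure TensorSymbol where
  a : ZMod 2
  b : ZMod 2
  m : deg K M a
  n : deg K N b

/-- The free (non-associative) superalgebra on the symbols `m ⊗ n`. -/
abbrev FreeTensor : Type (max u v w) := FreeNonUnitalNonAssocAlgebra K (TensorSymbol K M N)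

variable {K M N} in
/-- The degree of a non-associative word in the symbols `m ⊗ n`, where `|m ⊗ n| = |m| + |n|`. -/
def wordDeg : FreeMagma (TensorSymbol K M N) → ZMod 2
  | .of s => s.a + s.b
  | .mul v w => wordDeg v + wordDeg w

instance FreeTensor.supermodule : Supermodule K (FreeTensor K M N) where
  deg c := MonoidAlgebra.supported K K {w | wordDeg w = c}
  isCompl := by
    constructor
    · rw [Submodule.disjoint_def]
      intro x h0 h1
      rw [MonoidAlgebra.mem_supported'] at h0 h1
      ext w
      rcases zmod_two_cases (wordDeg w) with h | h
      · exact h1 w (by simp [h])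
      · exact h0 w (by simp [h])
    · rw [codisjoint_iff, eq_top_iff]
      intro x _
      induction x using MonoidAlgebra.induction_linear with
      | zero => exact zero_mem _
      | add x y hx hy => exact add_mem (hx trivial) (hy trivial)
      | single w r =>
        rcases zmod_two_cases (wordDeg w) with h | h
        · refine Submodule.mem_sup_left ?_
          rw [MonoidAlgebra.mem_supported']
          intro v hv
          refine Finsupp.single_eq_of_ne ?_
          rintro rfl
          exact hv h
        · refine Submodule.mem_sup_right ?_
          rw [MonoidAlgebra.mem_supported']
          intro v hv
          refine Finsupp.single_eq_of_ne ?_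
          rintro rfl
          exact hv h

variable {K M N}

theorem FreeTensor.mem_deg {c : ZMod 2} {x : FreeTensor K M N} :
    x ∈ deg K (FreeTensor K M N) c ↔ ∀ w, wordDeg w ≠ c → x.coeff w = 0 :=
  MonoidAlgebra.mem_supported'

theorem FreeTensor.mul_mem {a b : ZMod 2} {x y : FreeTensor K M N}
    (hx : x ∈ deg K (FreeTensor K M N) a) (hy : y ∈ deg K (FreeTensor K M N) b) :
    x * y ∈ deg K (FreeTensor K M N) (a + b) := by
  have hsp : ∀ c, deg K (FreeTensor K M N) c = Submodule.span K
      ((fun w => MonoidAlgebra.single w (1 : K)) '' {w | wordDeg w = c}) := fun c =>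
    MonoidAlgebra.supported_eq_span_single ..
  rw [hsp] at hx hy
  induction hx using Submodule.span_induction with
  | zero => rw [zero_mul]; exact zero_mem _
  | add x x' _ _ h h' => rw [add_mul]; exact add_mem h h'
  | smul r x _ h => rw [smul_mul_assoc]; exact Submodule.smul_mem _ _ h
  | mem x hx =>
    induction hy using Submodule.span_induction with
    | zero => rw [mul_zero]; exact zero_mem _
    | add y y' _ _ h h' => rw [mul_add]; exact add_mem h h'
    | smul r y _ h => rw [mul_smul_comm]; exact Submodule.smul_mem _ _ h
    | mem y hy =>
      obtain ⟨v, rfl, rfl⟩ := hx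
      obtain ⟨w, rfl, rfl⟩ := hy
      rw [hsp]
      refine Submodule.subset_span ⟨v * w, rfl, ?_⟩
      simp [MonoidAlgebra.single_mul_single]

/-- The generator `m ⊗ n` of the free superalgebra, for homogeneous `m` and `n`. -/
def gen {a b : ZMod 2} {m : M} {n : N} (hm : m ∈ deg K M a) (hn : n ∈ deg K N b) :
    FreeTensor K M N :=
  FreeNonUnitalNonAssocAlgebra.of K ⟨a, b, ⟨m, hm⟩, ⟨n, hn⟩⟩

theorem gen_mem {a b : ZMod 2} {m : M} {n : N} (hm : m ∈ deg K M a) (hn : n ∈ deg K N b) :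
    gen hm hn ∈ deg K (FreeTensor K M N) (a + b) := by
  rw [FreeTensor.mem_deg]
  intro w hw
  refine Finsupp.single_eq_of_ne ?_
  rintro rfl
  exact hw rfl

end Free

section Tensor

variable {K : Type u} {M : Type v} {N : Type w} [CommRing K]
  [AddCommGroup M] [Module K M] [LieSuperalgebra K M]
  [AddCommGroup N] [Module K N] [LieSuperalgebra K N]

/-- The elements of the free superalgebra on the symbols `m ⊗ n` that are to vanish in the
non-abelian tensor product: the first eight families are the defining relations, the last three
are the axioms of a Lie superalgebra. Here `α` and `β` are the actions of `M` on `N` and of `N`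
on `M`. -/
inductive TensorRel (α : LieSuperAction K M N) (β : LieSuperAction K N M) :
    FreeTensor K M N → Prop
  | smul_left (r : K) {a b : ZMod 2} {m : M} {n : N} (hm : m ∈ deg K M a) (hn : n ∈ deg K N b) :
      TensorRel α β (r • gen hm hn - gen (Submodule.smul_mem _ r hm) hn)
  | smul_right (r : K) {a b : ZMod 2} {m : M} {n : N} (hm : m ∈ deg K M a) (hn : n ∈ deg K N b) :
      TensorRel α β (r • gen hm hn - gen hm (Submodule.smul_mem _ r hn))
  | add_left {a b : ZMod 2} {m m' : M} {n : N} (hm : m ∈ deg K M a) (hm' : m' ∈ deg K M a)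
      (hn : n ∈ deg K N b) :
      TensorRel α β (gen (add_mem hm hm') hn - (gen hm hn + gen hm' hn))
  | add_right {a b : ZMod 2} {m : M} {n n' : N} (hm : m ∈ deg K M a) (hn : n ∈ deg K N b)
      (hn' : n' ∈ deg K N b) :
      TensorRel α β (gen hm (add_mem hn hn') - (gen hm hn + gen hm hn'))
  | brk_left {a a' b : ZMod 2} {m m' : M} {n : N} (hm : m ∈ deg K M a) (hm' : m' ∈ deg K M a')
      (hn : n ∈ deg K N b) :
      TensorRel α β (gen (brk_mem hm hm') hn -
        (gen hm (α.act_mem hm' hn) - sgn (a * a') • gen hm' (α.act_mem hm hn)))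
  | brk_right {a b b' : ZMod 2} {m : M} {n n' : N} (hm : m ∈ deg K M a) (hn : n ∈ deg K N b)
      (hn' : n' ∈ deg K N b') :
      TensorRel α β (gen hm (brk_mem hn hn') -
        (sgn (b' * (a + b)) • gen (β.act_mem hn' hm) hn -
          sgn (a * b) • gen (β.act_mem hn hm) hn'))
  | brk_gen {a b a' b' : ZMod 2} {m m' : M} {n n' : N} (hm : m ∈ deg K M a) (hn : n ∈ deg K N b)
      (hm' : m' ∈ deg K M a') (hn' : n' ∈ deg K N b') :
      TensorRel α β (gen hm hn * gen hm' hn' -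
        -(sgn (a * b) • gen (β.act_mem hn hm) (α.act_mem hm' hn')))
  | skew {i j : ZMod 2} {x y : FreeTensor K M N} (hx : x ∈ deg K (FreeTensor K M N) i)
      (hy : y ∈ deg K (FreeTensor K M N) j) :
      TensorRel α β (x * y - -(sgn (i * j) • (y * x)))
  | jacobi {i j k : ZMod 2} {x y z : FreeTensor K M N} (hx : x ∈ deg K (FreeTensor K M N) i)
      (hy : y ∈ deg K (FreeTensor K M N) j) (hz : z ∈ deg K (FreeTensor K M N) k) :
      TensorRel α β (x * (y * z) - (x * y * z + sgn (i * j) • (y * (x * z))))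
  | brk_self {x : FreeTensor K M N} (hx : x ∈ deg K (FreeTensor K M N) 0) :
      TensorRel α β (x * x)

/-- The ideal of the free superalgebra generated by the relations. -/
def tensorIdeal (α : LieSuperAction K M N) (β : LieSuperAction K N M) :
    Submodule K (FreeTensor K M N) :=
  sInf {I | (∀ t, TensorRel α β t → t ∈ I) ∧ ∀ x, ∀ t ∈ I, x * t ∈ I ∧ t * x ∈ I}

variable (α : LieSuperAction K M N) (β : LieSuperAction K N M)

theorem tensorIdeal_le {I : Submodule K (FreeTensor K M N)} (h : ∀ t, TensorRel α β t → t ∈ I)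
    (h' : ∀ x, ∀ t ∈ I, x * t ∈ I ∧ t * x ∈ I) : tensorIdeal α β ≤ I :=
  sInf_le ⟨h, h'⟩

variable {α β}

theorem mem_tensorIdeal {t : FreeTensor K M N} (h : TensorRel α β t) : t ∈ tensorIdeal α β :=
  Submodule.mem_sInf.2 fun _ hI => hI.1 t h

theorem mul_mem_tensorIdeal (x : FreeTensor K M N) {t : FreeTensor K M N}
    (h : t ∈ tensorIdeal α β) : x * t ∈ tensorIdeal α β ∧ t * x ∈ tensorIdeal α β :=
  ⟨Submodule.mem_sInf.2 fun I hI => (hI.2 x t (Submodule.mem_sInf.1 h I hI)).1,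
    Submodule.mem_sInf.2 fun I hI => (hI.2 x t (Submodule.mem_sInf.1 h I hI)).2⟩

theorem TensorRel.homogeneous {t : FreeTensor K M N} (h : TensorRel α β t) :
    ∃ c, t ∈ deg K (FreeTensor K M N) c := by
  have cast : ∀ {c d : ZMod 2} {x : FreeTensor K M N}, x ∈ deg K (FreeTensor K M N) c → c = d →
      x ∈ deg K (FreeTensor K M N) d := fun h e => e ▸ h
  cases h with
  | smul_left r hm hn =>
    exact ⟨_, sub_mem (Submodule.smul_mem _ r (gen_mem hm hn)) (gen_mem _ hn)⟩
  | smul_right r hm hn =>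
    exact ⟨_, sub_mem (Submodule.smul_mem _ r (gen_mem hm hn)) (gen_mem hm _)⟩
  | add_left hm hm' hn =>
    exact ⟨_, sub_mem (gen_mem _ hn) (add_mem (gen_mem hm hn) (gen_mem hm' hn))⟩
  | add_right hm hn hn' =>
    exact ⟨_, sub_mem (gen_mem hm _) (add_mem (gen_mem hm hn) (gen_mem hm hn'))⟩
  | brk_left hm hm' hn =>
    exact ⟨_, sub_mem (gen_mem _ hn) (sub_mem (cast (gen_mem hm _) (by abel))
      (zsmul_mem (cast (gen_mem hm' _) (by abel)) _))⟩
  | brk_right hm hn hn' =>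
    exact ⟨_, sub_mem (gen_mem hm _) (sub_mem (zsmul_mem (cast (gen_mem _ hn) (by abel)) _)
      (zsmul_mem (cast (gen_mem _ hn') (by abel)) _))⟩
  | brk_gen hm hn hm' hn' =>
    exact ⟨_, sub_mem (FreeTensor.mul_mem (gen_mem hm hn) (gen_mem hm' hn'))
      (neg_mem (zsmul_mem (cast (gen_mem _ _) (by abel)) _))⟩
  | skew hx hy =>
    exact ⟨_, sub_mem (FreeTensor.mul_mem hx hy)
      (neg_mem (zsmul_mem (cast (FreeTensor.mul_mem hy hx) (by abel)) _))⟩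
  | jacobi hx hy hz =>
    exact ⟨_, sub_mem (FreeTensor.mul_mem hx (FreeTensor.mul_mem hy hz))
      (add_mem (cast (FreeTensor.mul_mem (FreeTensor.mul_mem hx hy) hz) (by abel))
        (zsmul_mem (cast (FreeTensor.mul_mem hy (FreeTensor.mul_mem hx hz)) (by abel)) _))⟩
  | brk_self hx => exact ⟨_, FreeTensor.mul_mem hx hx⟩

variable (α β)

theorem tensorIdeal_graded : IsGraded (tensorIdeal α β) := by
  have hle : tensorIdeal α β ≤ ⨅ i, (tensorIdeal α β).comap (proj K i) := by
    refine tensorIdeal_le α β ?_ ?_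
    · intro t ht
      rw [Submodule.mem_iInf]
      intro i
      obtain ⟨c, hc⟩ := ht.homogeneous
      by_cases h : i = c
      · subst h
        rw [Submodule.mem_comap, proj_same hc]
        exact mem_tensorIdeal ht
      · rw [Submodule.mem_comap, proj_other h hc]
        exact zero_mem _
    · intro x t ht
      simp only [Submodule.mem_iInf, Submodule.mem_comap] at ht ⊢
      have hom : ∀ (i c : ZMod 2) (s : FreeTensor K M N), s ∈ deg K (FreeTensor K M N) c →
          s ∈ tensorIdeal α β → proj K i s ∈ tensorIdeal α β := by
        intro i c s hs hs'
        by_cases h : i = c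
        · subst h; rwa [proj_same hs]
        · rw [proj_other h hs]; exact zero_mem _
      obtain ⟨x₀, hx₀, x₁, hx₁, rfl⟩ := exists_decomp K x
      rw [← proj_zero_add_proj_one (K := K) t]
      simp only [add_mul, mul_add, map_add]
      have l : ∀ i a b x, x ∈ deg K (FreeTensor K M N) a →
          proj K i (x * proj K b t) ∈ tensorIdeal α β := fun i a b x hx =>
        hom i _ _ (FreeTensor.mul_mem hx (proj_mem b t)) (mul_mem_tensorIdeal x (ht b)).1
      have r : ∀ i a b x, x ∈ deg K (FreeTensor K M N) a →
          proj K i (proj K b t * x) ∈ tensorIdeal α β := fun i a b x hx =>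
        hom i _ _ (FreeTensor.mul_mem (proj_mem b t) hx) (mul_mem_tensorIdeal x (ht b)).2
      constructor <;> intro i
      · exact add_mem (add_mem (l _ _ _ _ hx₀) (l _ _ _ _ hx₁))
          (add_mem (l _ _ _ _ hx₀) (l _ _ _ _ hx₁))
      · exact add_mem (add_mem (r _ _ _ _ hx₀) (r _ _ _ _ hx₀))
          (add_mem (r _ _ _ _ hx₁) (r _ _ _ _ hx₁))
  intro i x hx
  exact (Submodule.mem_iInf _).1 (hle hx) i

/-- The non-abelian tensor product `M ⊗ N`: the Lie superalgebra generated by the symbols `m ⊗ n`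
subject to the defining relations. -/
abbrev NATensor : Type (max u v w) := FreeTensor K M N ⧸ tensorIdeal α β

instance NATensor.supermodule : Supermodule K (NATensor α β) :=
  Supermodule.ofQuotient _ (tensorIdeal_graded α β)

variable {α β}

theorem NATensor.mem_deg {c : ZMod 2} {q : NATensor α β} :
    q ∈ deg K (NATensor α β) c ↔
      ∃ x ∈ deg K (FreeTensor K M N) c, (tensorIdeal α β).mkQ x = q := Iff.rfl

theorem NATensor.eq_of_rel {s t : FreeTensor K M N} (h : TensorRel α β (s - t)) :
    (tensorIdeal α β).mkQ s = (tensorIdeal α β).mkQ t :=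
  (Submodule.Quotient.eq _).2 (mem_tensorIdeal h)

variable (α β)

instance NATensor.lieSuperalgebra : LieSuperalgebra K (NATensor α β) where
  toSupermodule := NATensor.supermodule α β
  brk := (tensorIdeal α β).liftQ
    (LinearMap.flip ((tensorIdeal α β).liftQ
      (LinearMap.flip ((LinearMap.mul K (FreeTensor K M N)).compr₂ (tensorIdeal α β).mkQ)) (by
        intro t ht
        refine LinearMap.ext fun x => ?_
        exact (Submodule.Quotient.mk_eq_zero _).2 (mul_mem_tensorIdeal x ht).1))) (by
    intro t ht
    refine Submodule.linearMap_qext _ (LinearMap.ext fun x => ?_)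
    exact (Submodule.Quotient.mk_eq_zero _).2 (mul_mem_tensorIdeal x ht).2)
  brk_mem := fun hx hy => by
    obtain ⟨x, hx', rfl⟩ := NATensor.mem_deg.1 hx
    obtain ⟨y, hy', rfl⟩ := NATensor.mem_deg.1 hy
    exact NATensor.mem_deg.2 ⟨x * y, FreeTensor.mul_mem hx' hy', rfl⟩
  skew := fun hx hy => by
    obtain ⟨x, hx', rfl⟩ := NATensor.mem_deg.1 hx
    obtain ⟨y, hy', rfl⟩ := NATensor.mem_deg.1 hy
    exact NATensor.eq_of_rel (TensorRel.skew hx' hy')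
  jacobi := fun hx hy hz => by
    obtain ⟨x, hx', rfl⟩ := NATensor.mem_deg.1 hx
    obtain ⟨y, hy', rfl⟩ := NATensor.mem_deg.1 hy
    obtain ⟨z, hz', rfl⟩ := NATensor.mem_deg.1 hz
    exact NATensor.eq_of_rel (TensorRel.jacobi hx' hy' hz')
  brk_self := fun hx => by
    obtain ⟨x, hx', rfl⟩ := NATensor.mem_deg.1 hx
    exact (Submodule.Quotient.mk_eq_zero _).2 (mem_tensorIdeal (TensorRel.brk_self hx'))

/-- The element `m ⊗ n` of the non-abelian tensor product for homogeneous `m` and `n`. -/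
def NATensor.tmulHom {a b : ZMod 2} {m : M} {n : N} (hm : m ∈ deg K M a) (hn : n ∈ deg K N b) :
    NATensor α β := (tensorIdeal α β).mkQ (gen hm hn)

variable {α β}

theorem NATensor.tmulHom_congr {a b : ZMod 2} {m m' : M} {n n' : N} (hm : m ∈ deg K M a)
    (hm' : m' ∈ deg K M a) (hn : n ∈ deg K N b) (hn' : n' ∈ deg K N b) (e : m = m') (f : n = n') :
    NATensor.tmulHom α β hm hn = NATensor.tmulHom α β hm' hn' := by
  subst e f; rfl

theorem NATensor.add_tmulHom {a b : ZMod 2} {m m' : M} {n : N} (hm : m ∈ deg K M a)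
    (hm' : m' ∈ deg K M a) (hn : n ∈ deg K N b) :
    NATensor.tmulHom α β (add_mem hm hm') hn =
      NATensor.tmulHom α β hm hn + NATensor.tmulHom α β hm' hn :=
  NATensor.eq_of_rel (TensorRel.add_left hm hm' hn)

theorem NATensor.tmulHom_add {a b : ZMod 2} {m : M} {n n' : N} (hm : m ∈ deg K M a)
    (hn : n ∈ deg K N b) (hn' : n' ∈ deg K N b) :
    NATensor.tmulHom α β hm (add_mem hn hn') =
      NATensor.tmulHom α β hm hn + NATensor.tmulHom α β hm hn' :=
  NATensor.eq_of_rel (TensorRel.add_right hm hn hn')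

theorem NATensor.smul_tmulHom (r : K) {a b : ZMod 2} {m : M} {n : N} (hm : m ∈ deg K M a)
    (hn : n ∈ deg K N b) :
    NATensor.tmulHom α β (Submodule.smul_mem _ r hm) hn = r • NATensor.tmulHom α β hm hn :=
  (NATensor.eq_of_rel (TensorRel.smul_left r hm hn)).symm

theorem NATensor.tmulHom_smul (r : K) {a b : ZMod 2} {m : M} {n : N} (hm : m ∈ deg K M a)
    (hn : n ∈ deg K N b) :
    NATensor.tmulHom α β hm (Submodule.smul_mem _ r hn) = r • NATensor.tmulHom α β hm hn :=
  (NATensor.eq_of_rel (TensorRel.smul_right r hm hn)).symm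

variable (α β)

/-- The element `m ⊗ n` of the non-abelian tensor product for arbitrary `m` and `n`: the sum of
the `m_a ⊗ n_b` over the homogeneous components. -/
def NATensor.tmul : M →ₗ[K] N →ₗ[K] NATensor α β :=
  LinearMap.mk₂ K
    (fun m n => ∑ a : ZMod 2, ∑ b : ZMod 2,
      NATensor.tmulHom α β (proj_mem (K := K) a m) (proj_mem (K := K) b n))
    (by
      intro m m' n
      simp only [← Finset.sum_add_distrib, ← NATensor.add_tmulHom]
      exact Finset.sum_congr rfl fun a _ => Finset.sum_congr rfl fun b _ =>
        NATensor.tmulHom_congr _ _ _ _ (map_add _ _ _) rfl)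
    (by
      intro r m n
      simp only [Finset.smul_sum, ← NATensor.smul_tmulHom]
      exact Finset.sum_congr rfl fun a _ => Finset.sum_congr rfl fun b _ =>
        NATensor.tmulHom_congr _ _ _ _ (map_smul _ _ _) rfl)
    (by
      intro m n n'
      simp only [← Finset.sum_add_distrib, ← NATensor.tmulHom_add]
      exact Finset.sum_congr rfl fun a _ => Finset.sum_congr rfl fun b _ =>
        NATensor.tmulHom_congr _ _ _ _ rfl (map_add _ _ _))
    (by
      intro r m n
      simp only [Finset.smul_sum, ← NATensor.tmulHom_smul]
      exact Finset.sum_congr rfl fun a _ => Finset.sum_congr rfl fun b _ =>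
        NATensor.tmulHom_congr _ _ _ _ rfl (map_smul _ _ _))

end Tensor

/-! ### The non-abelian exterior product of crossed modules -/

section Evaluation

variable {K : Type u} {M : Type v} {N : Type w} {L : Type w'} [CommRing K]
  [AddCommGroup M] [Module K M] [Supermodule K M]
  [AddCommGroup N] [Module K N] [Supermodule K N]
  [AddCommGroup L] [Module K L] [LieSuperalgebra K L]

/-- Evaluation of a word in the symbols `m ⊗ n` in a Lie superalgebra. -/
def evalWord (f : TensorSymbol K M N → L) : FreeMagma (TensorSymbol K M N) → L
  | .of s => f s
  | .mul v w => brk K (evalWord f v) (evalWord f w)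

/-- The linear map on the free superalgebra that sends products to brackets and extends `f`. -/
def freeLift (f : TensorSymbol K M N → L) : FreeTensor K M N →ₗ[K] L :=
  Finsupp.linearCombination K (evalWord f) ∘ₗ (MonoidAlgebra.coeffLinearEquiv K).toLinearMap

theorem freeLift_single (f : TensorSymbol K M N → L) (w : FreeMagma (TensorSymbol K M N)) (r : K) :
    freeLift f (MonoidAlgebra.single w r) = r • evalWord f w := by
  simp [freeLift]

theorem freeLift_mul (f : TensorSymbol K M N → L) (x y : FreeTensor K M N) :
    freeLift f (x * y) = brk K (freeLift f x) (freeLift f y) := by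
  induction x using MonoidAlgebra.induction_linear with
  | zero => simp
  | add x x' h h' => simp only [add_mul, map_add, h, h', LinearMap.add_apply]
  | single v r =>
    induction y using MonoidAlgebra.induction_linear with
    | zero => simp
    | add y y' h h' => simp only [mul_add, map_add, h, h']
    | single w s =>
      rw [MonoidAlgebra.single_mul_single, freeLift_single, freeLift_single, freeLift_single]
      simp only [map_smul, LinearMap.smul_apply, smul_smul, mul_comm r s]
      rfl

theorem freeLift_gen (f : TensorSymbol K M N → L) {a b : ZMod 2} {m : M} {n : N}
    (hm : m ∈ deg K M a) (hn : n ∈ deg K N b) :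
    freeLift f (gen hm hn) = f ⟨a, b, ⟨m, hm⟩, ⟨n, hn⟩⟩ :=
  (freeLift_single f _ 1).trans (one_smul K _)

theorem freeLift_mem (f : TensorSymbol K M N → L) (hf : ∀ s, f s ∈ deg K L (s.a + s.b))
    {c : ZMod 2} {x : FreeTensor K M N} (hx : x ∈ deg K (FreeTensor K M N) c) :
    freeLift f x ∈ deg K L c := by
  have hw : ∀ w, evalWord f w ∈ deg K L (wordDeg w) := by
    intro w
    induction w with
    | ih1 s => exact hf s
    | ih2 v w hv hw => exact brk_mem hv hw
  rw [FreeTensor.mem_deg] at hx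
  change Finsupp.linearCombination K (evalWord f) x.coeff ∈ _
  rw [Finsupp.linearCombination_apply]
  refine Submodule.sum_mem _ fun w hw' => Submodule.smul_mem _ _ ?_
  have : wordDeg w = c := by
    by_contra h
    exact (Finsupp.mem_support_iff.1 hw') (hx w h)
  exact this ▸ hw w

end Evaluation

section ExteriorProduct

variable {K : Type u} {P : Type v} {M : Type w} {N : Type w'} [CommRing K]
  [AddCommGroup P] [Module K P] [LieSuperalgebra K P]
  [AddCommGroup M] [Module K M] [LieSuperalgebra K M]
  [AddCommGroup N] [Module K N] [LieSuperalgebra K N]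
  (C : CrossedModule K P M) (D : CrossedModule K P N)

/-- The non-abelian tensor product of two crossed `P`-modules, which act on each other via `P`. -/
abbrev CrossedTensor : Type (max u w w') := NATensor (C.actionOn D) (D.actionOn C)

/-- The submodule `M □ N` of `M ⊗ N` spanned by the elements `m ⊗ n + (-1)^(|m'||n'|) m' ⊗ n'` for
homogeneous `m`, `n`, `m'`, `n'` with `∂ m = ∂' n'` and `∂ m' = ∂' n`, and the elements `m ⊗ n` for
even `m`, `n` with `∂ m = ∂' n`. -/
def square : Submodule K (CrossedTensor C D) :=
  Submodule.span K
    ({t | ∃ (a b a' b' : ZMod 2) (m m' : M) (n n' : N) (hm : m ∈ deg K M a) (hn : n ∈ deg K N b)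
        (hm' : m' ∈ deg K M a') (hn' : n' ∈ deg K N b'),
        C.bd.toLinearMap m = D.bd.toLinearMap n' ∧ C.bd.toLinearMap m' = D.bd.toLinearMap n ∧
        t = NATensor.tmulHom _ _ hm hn + sgn (a' * b') • NATensor.tmulHom _ _ hm' hn'} ∪
      {t | ∃ (m : M) (n : N) (hm : m ∈ deg K M 0) (hn : n ∈ deg K N 0),
        C.bd.toLinearMap m = D.bd.toLinearMap n ∧ t = NATensor.tmulHom _ _ hm hn})

/-- The non-abelian exterior product `M ∧ N = (M ⊗ N) / (M □ N)`. -/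
abbrev ExteriorProduct : Type (max u w w') := CrossedTensor C D ⧸ square C D

/-- The element `m ∧ n` of the non-abelian exterior product. -/
def ExteriorProduct.wedge : M →ₗ[K] N →ₗ[K] ExteriorProduct C D :=
  (NATensor.tmul _ _).compr₂ (square C D).mkQ

/-- The grading of `M ∧ N`. -/
def ExteriorProduct.deg (a : ZMod 2) : Submodule K (ExteriorProduct C D) :=
  (SuperLie.deg K (CrossedTensor C D) a).map (square C D).mkQ

/-- The map on symbols that induces `M ⊗ N → P`. -/
def symbolMap (s : TensorSymbol K M N) : P :=
  brk K (C.bd.toLinearMap s.m) (D.bd.toLinearMap s.n)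

theorem tensorIdeal_le_ker :
    tensorIdeal (C.actionOn D) (D.actionOn C) ≤ LinearMap.ker (freeLift (symbolMap C D)) := by
  have hs : ∀ s, symbolMap C D s ∈ deg K P (s.a + s.b) := fun s =>
    brk_mem (C.bd.map_deg _ _ s.m.2) (D.bd.map_deg _ _ s.n.2)
  refine tensorIdeal_le _ _ ?_ ?_
  · intro t ht
    rw [LinearMap.mem_ker]
    cases ht with
    | smul_left r hm hn => simp [freeLift_gen, symbolMap]
    | smul_right r hm hn => simp [freeLift_gen, symbolMap]
    | add_left hm hm' hn => simp [freeLift_gen, symbolMap]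
    | add_right hm hn hn' => simp [freeLift_gen, symbolMap]
    | brk_left hm hm' hn =>
      simp only [map_sub, map_zsmul, freeLift_gen, symbolMap, CrossedModule.actionOn_act,
        C.bd.map_brk, D.bd_act]
      rw [jacobi (C.bd.map_deg _ _ hm) (C.bd.map_deg _ _ hm') (D.bd.map_deg _ _ hn)]
      abel
    | @brk_right a b b' m n n' hm hn hn' =>
      simp only [map_sub, map_zsmul, freeLift_gen, symbolMap, CrossedModule.actionOn_act,
        D.bd.map_brk, C.bd_act]
      have hx := C.bd.map_deg _ _ hm
      have hy := D.bd.map_deg _ _ hn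
      have hz := D.bd.map_deg _ _ hn'
      rw [jacobi hx hy hz, skew hz hx, skew hy hx, skew hy (brk_mem hx hz)]
      simp only [map_neg, map_zsmul, LinearMap.neg_apply, LinearMap.smul_apply]
      rcases zmod_two_cases a with rfl | rfl <;> rcases zmod_two_cases b with rfl | rfl <;>
        rcases zmod_two_cases b' with rfl | rfl <;>
        simp [sgn_zero, sgn_one, one_add_one_zmod] <;> abel
    | brk_gen hm hn hm' hn' =>
      simp only [map_sub, map_neg, map_zsmul, freeLift_mul, freeLift_gen, symbolMap,
        CrossedModule.actionOn_act, C.bd_act, D.bd_act]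
      rw [skew (C.bd.map_deg _ _ hm) (D.bd.map_deg _ _ hn)]
      simp
    | skew hx hy =>
      simp only [map_sub, map_neg, map_zsmul, freeLift_mul]
      rw [skew (freeLift_mem _ hs hx) (freeLift_mem _ hs hy), sub_self]
    | jacobi hx hy hz =>
      simp only [map_sub, map_add, map_zsmul, freeLift_mul]
      rw [jacobi (freeLift_mem _ hs hx) (freeLift_mem _ hs hy) (freeLift_mem _ hs hz), sub_self]
    | brk_self hx =>
      rw [freeLift_mul, brk_self (freeLift_mem _ hs hx)]
  · intro x t ht
    rw [LinearMap.mem_ker] at ht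
    simp [LinearMap.mem_ker, freeLift_mul, ht]

/-- The homomorphism `M ⊗ N → P`, `m ⊗ n ↦ [∂ m, ∂' n]`. -/
def tensorToBase : CrossedTensor C D →ₗ[K] P :=
  (tensorIdeal _ _).liftQ (freeLift (symbolMap C D)) (tensorIdeal_le_ker C D)

theorem tensorToBase_tmulHom {a b : ZMod 2} {m : M} {n : N} (hm : m ∈ deg K M a)
    (hn : n ∈ deg K N b) :
    tensorToBase C D (NATensor.tmulHom _ _ hm hn) =
      brk K (C.bd.toLinearMap m) (D.bd.toLinearMap n) :=
  freeLift_gen _ hm hn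

theorem square_le_ker : square C D ≤ LinearMap.ker (tensorToBase C D) := by
  refine Submodule.span_le.2 ?_
  rintro _ (⟨a, b, a', b', m, m', n, n', hm, hn, hm', hn', e, e', rfl⟩ | ⟨m, n, hm, hn, e, rfl⟩)
  · rw [SetLike.mem_coe, LinearMap.mem_ker, map_add, map_zsmul, tensorToBase_tmulHom,
      tensorToBase_tmulHom, e']
    have h1 := C.bd.map_deg _ _ hm
    have h2 := D.bd.map_deg _ _ hn
    have h1' := C.bd.map_deg _ _ hm'
    have h2' := D.bd.map_deg _ _ hn'
    by_cases h : a = b'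
    · by_cases h' : b = a'
      · subst h h'
        rw [skew h1 h2, e, mul_comm]
        simp
      · rw [e'] at h1'
        simp [eq_zero_of_mem_deg h' h2 h1']
    · rw [e] at h1
      simp [e, eq_zero_of_mem_deg h h1 h2']
  · rw [SetLike.mem_coe, LinearMap.mem_ker, tensorToBase_tmulHom, ← e]
    exact brk_self (C.bd.map_deg _ _ hm)

/-- The homomorphism `M ∧ N → P`, `m ∧ n ↦ [∂ m, ∂' n]`. -/
def ExteriorProduct.toBase : ExteriorProduct C D →ₗ[K] P :=
  (square C D).liftQ (tensorToBase C D) (square_le_ker C D)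

theorem ExteriorProduct.toBase_wedge (m : M) (n : N) :
    ExteriorProduct.toBase C D (ExteriorProduct.wedge C D m n) =
      brk K (C.bd.toLinearMap m) (D.bd.toLinearMap n) := by
  have hs : (Finset.univ : Finset (ZMod 2)) = {0, 1} := by decide
  have h01 : (0 : ZMod 2) ≠ 1 := by decide
  change tensorToBase C D (NATensor.tmul _ _ m n) = _
  simp only [NATensor.tmul, LinearMap.mk₂_apply, hs, Finset.sum_pair h01, map_add,
    tensorToBase_tmulHom]
  conv_rhs => rw [← proj_zero_add_proj_one (K := K) m, ← proj_zero_add_proj_one (K := K) n]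
  simp only [map_add, LinearMap.add_apply]
  abel

end ExteriorProduct

section IdealExterior

variable {K : Type u} {P : Type v} [CommRing K] [AddCommGroup P] [Module K P]
  [LieSuperalgebra K P] (M : GradedIdeal K P)

/-- The non-abelian exterior product `P ∧ M` for a graded ideal `M` of `P`. -/
abbrev GradedIdeal.Ext : Type (max u v) :=
  ExteriorProduct (CrossedModule.self K P) (CrossedModule.ofIdeal M)

/-- The homomorphism `P ∧ M → P`, `p ∧ m ↦ [p, m]`. -/
abbrev GradedIdeal.extToBase : M.Ext →ₗ[K] P :=
  ExteriorProduct.toBase (CrossedModule.self K P) (CrossedModule.ofIdeal M)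

/-- The canonical map `P ⊗_K M → P ∧ M` from the tensor product of modules. -/
def GradedIdeal.toExt : P ⊗[K] M.toSubmodule →ₗ[K] M.Ext :=
  TensorProduct.lift
    (ExteriorProduct.wedge (CrossedModule.self K P) (CrossedModule.ofIdeal M))

/-- The canonical map `P ⊗_K M → Λ²(P)`, `p ⊗ m ↦ p ∧ m`. -/
def GradedIdeal.toWedge₂ : P ⊗[K] M.toSubmodule →ₗ[K] Wedge₂ K P :=
  (wedgeRel₂ K P).mkQ ∘ₗ TensorProduct.map LinearMap.id M.toSubmodule.subtype

theorem GradedIdeal.d₂_toWedge₂ (t : P ⊗[K] M.toSubmodule) :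
    d₂ K P (M.toWedge₂ t) = -M.extToBase (M.toExt t) := by
  induction t using TensorProduct.induction_on with
  | zero => simp
  | add s t hs ht => simp only [map_add, hs, ht, neg_add]
  | tmul p m =>
    exact (d₂_wedge₂ p (m : P)).trans (congrArg Neg.neg
      (ExteriorProduct.toBase_wedge (CrossedModule.self K P) (CrossedModule.ofIdeal M) p m).symm)

/-- The grading of `Ker (P ∧ M → P)`. -/
def GradedIdeal.kerDeg (a : ZMod 2) : Submodule K (LinearMap.ker M.extToBase) :=
  (ExteriorProduct.deg _ _ a).comap (LinearMap.ker M.extToBase).subtype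

/-- The supermodule `M / [P, M]`. -/
abbrev GradedIdeal.Coinv : Type v :=
  M.toSubmodule ⧸ (brkSpan (⊤ : Submodule K P) M.toSubmodule).submoduleOf M.toSubmodule

/-- The grading of `M / [P, M]`. -/
def GradedIdeal.coinvDeg (a : ZMod 2) : Submodule K M.Coinv :=
  (SuperLie.deg K M.toSubmodule a).map (Submodule.mkQ _)

end IdealExterior

end SuperLie

end

open SuperLie

/-!
Let `L = Λ²(P) / d₃ Λ³(P)`. The vanishing of `d₃ (x ∧ y ∧ z)` is a Jacobi identity in disguise, and
it makes `L` a Lie superalgebra under `[u, v] = d₂ u ∧ d₂ v`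
(`SuperLie.ChainQuot.lieSuperalgebra`). The assignment `p ⊗ m ↦ p ∧ m` respects all the defining
relations of the non-abelian exterior product, so it induces a map `P ∧ M → L`
(`SuperLie.GradedIdeal.extToChain`). By this map, the class of the cycle `∑ p ∧ m` in `H₂(P)`
depends only on the element `∑ p ∧ m` of `P ∧ M`. Every element of `P ∧ M` has this form, since the
bracket of two symbols `p ⊗ m` is a symbol up to sign (`SuperLie.NATensor.span_tmulHom`).

The rest is a diagram chase for the surjection of complexes `Λ(P) → Λ(P / M)` in degrees at most
three. It rests on two facts: the kernel of `Λ²(P) → Λ²(P / M)` is the image of `P ⊗ M`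
(`SuperLie.GradedIdeal.ker_wedge₂Map_mkHom`), whose image under `d₂` is `[P, M]`
(`SuperLie.GradedIdeal.range_d₂_comp_toWedge₂`), and boundaries in `Λ²(P / M)` lift to boundaries in
`Λ²(P)` (`SuperLie.GradedIdeal.exists_wedge₂Map_d₃_eq`).
-/

noncomputable section

namespace SuperLie

universe u v w

/-! ### Linear algebra -/

/-- A linear map factors through a surjection whose kernel it kills. -/
theorem exists_factor_of_surjective {K : Type*} {A B C : Type*} [CommRing K] [AddCommGroup A]
    [Module K A] [AddCommGroup B] [Module K B] [AddCommGroup C] [Module K C] {g : A →ₗ[K] B}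
    {h : A →ₗ[K] C} (hg : Function.Surjective g) (hk : LinearMap.ker g ≤ LinearMap.ker h) :
    ∃ φ : B →ₗ[K] C, ∀ a, φ (g a) = h a := by
  refine ⟨(LinearMap.ker g).liftQ h hk ∘ₗ (g.quotKerEquivOfSurjective hg).symm.toLinearMap,
    fun a => ?_⟩
  have : (g.quotKerEquivOfSurjective hg).symm (g a) = (LinearMap.ker g).mkQ a := by
    rw [LinearEquiv.symm_apply_eq]; rfl
  simp [this]

/-! ### The grading of the super exterior square -/

section Grading

variable {K : Type u} {P : Type v} [CommRing K] [AddCommGroup P] [Module K P]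

section Supermodule

variable [Supermodule K P]

theorem wedge₂_mem_wedge₂Deg {a b c : ZMod 2} {x y : P} (hx : x ∈ deg K P a)
    (hy : y ∈ deg K P b) (h : a + b = c) : wedge₂ K x y ∈ wedge₂Deg K P c :=
  Submodule.subset_span ⟨a, b, x, y, hx, hy, h, rfl⟩

variable (K P) in
/-- The projection of `P ⊗ P` onto its component `P₀ ⊗ P_c ⊕ P₁ ⊗ P_(c+1)` of degree `c`. -/
def tensorProj (c : ZMod 2) : P ⊗[K] P →ₗ[K] P ⊗[K] P :=
  TensorProduct.map (proj K 0) (proj K c) + TensorProduct.map (proj K 1) (proj K (c + 1))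

theorem tensorProj_tmul_same {a b c : ZMod 2} {x y : P} (hx : x ∈ deg K P a)
    (hy : y ∈ deg K P b) (h : a + b = c) : tensorProj K P c (x ⊗ₜ[K] y) = x ⊗ₜ[K] y := by
  have h01 : (0 : ZMod 2) ≠ 1 := by decide
  rcases zmod_two_cases a with rfl | rfl
  · obtain rfl : b = c := by rw [← h, zero_add]
    simp [tensorProj, proj_same hx, proj_same hy, proj_other h01.symm hx]
  · obtain rfl : b = c + 1 := by
      rw [← h, add_comm 1 b, add_assoc, one_add_one_zmod, add_zero]
    simp [tensorProj, proj_same hx, proj_same hy, proj_other h01 hx]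

theorem tensorProj_tmul_other {a b c : ZMod 2} {x y : P} (hx : x ∈ deg K P a)
    (hy : y ∈ deg K P b) (h : a + b ≠ c) : tensorProj K P c (x ⊗ₜ[K] y) = 0 := by
  have h01 : (0 : ZMod 2) ≠ 1 := by decide
  rcases zmod_two_cases a with rfl | rfl
  · have hb : c ≠ b := by rintro rfl; simp at h
    simp [tensorProj, proj_other hb hy, proj_other h01.symm hx]
  · have hb : c + 1 ≠ b := by
      rintro rfl
      rw [add_comm c 1, ← add_assoc, one_add_one_zmod, zero_add] at h
      exact h rfl
    simp [tensorProj, proj_other hb hy, proj_other h01 hx]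

theorem wedgeRel₂_le_comap_tensorProj (c : ZMod 2) :
    wedgeRel₂ K P ≤ (wedgeRel₂ K P).comap (tensorProj K P c) := by
  refine Submodule.span_le.2 ?_
  rintro _ (⟨a, b, x, y, hx, hy, rfl⟩ | ⟨x, hx, rfl⟩)
  · by_cases h : a + b = c
    · have h' : b + a = c := by rw [add_comm, h]
      simp only [SetLike.mem_coe, Submodule.mem_comap, map_add, map_zsmul,
        tensorProj_tmul_same hx hy h, tensorProj_tmul_same hy hx h']
      exact Submodule.subset_span (Or.inl ⟨a, b, x, y, hx, hy, rfl⟩)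
    · have h' : b + a ≠ c := by rwa [add_comm]
      simp [tensorProj_tmul_other hx hy h, tensorProj_tmul_other hy hx h']
  · by_cases h : (0 : ZMod 2) + 0 = c
    · simp only [SetLike.mem_coe, Submodule.mem_comap, tensorProj_tmul_same hx hx h]
      exact Submodule.subset_span (Or.inr ⟨x, hx, rfl⟩)
    · simp [tensorProj_tmul_other hx hx h]

variable (K P) in
/-- The projection of `Λ²(P)` onto its component of degree `c`. -/
def wedge₂Proj (c : ZMod 2) : Wedge₂ K P →ₗ[K] Wedge₂ K P :=
  (wedgeRel₂ K P).mapQ (wedgeRel₂ K P) (tensorProj K P c) (wedgeRel₂_le_comap_tensorProj c)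

theorem wedge₂Proj_same {c : ZMod 2} {z : Wedge₂ K P} (hz : z ∈ wedge₂Deg K P c) :
    wedge₂Proj K P c z = z := by
  suffices h : wedge₂Deg K P c ≤ LinearMap.eqLocus (wedge₂Proj K P c) LinearMap.id from h hz
  refine Submodule.span_le.2 ?_
  rintro _ ⟨a, b, x, y, hx, hy, h, rfl⟩
  exact congrArg (wedgeRel₂ K P).mkQ (tensorProj_tmul_same hx hy h)

theorem wedge₂Proj_other {c d : ZMod 2} (hcd : d ≠ c) {z : Wedge₂ K P}
    (hz : z ∈ wedge₂Deg K P d) : wedge₂Proj K P c z = 0 := by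
  suffices h : wedge₂Deg K P d ≤ LinearMap.ker (wedge₂Proj K P c) from h hz
  refine Submodule.span_le.2 ?_
  rintro _ ⟨a, b, x, y, hx, hy, rfl, rfl⟩
  exact (congrArg (wedgeRel₂ K P).mkQ (tensorProj_tmul_other hx hy hcd)).trans (map_zero _)

theorem wedge₂Deg_sup : wedge₂Deg K P 0 ⊔ wedge₂Deg K P 1 = ⊤ := by
  rw [eq_top_iff]
  rintro z -
  obtain ⟨t, rfl⟩ := (wedgeRel₂ K P).mkQ_surjective z
  induction t using TensorProduct.induction_on with
  | zero => exact zero_mem _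
  | add s t hs ht => rw [map_add]; exact add_mem hs ht
  | tmul x y =>
    obtain ⟨x₀, hx₀, x₁, hx₁, rfl⟩ := exists_decomp K x
    obtain ⟨y₀, hy₀, y₁, hy₁, rfl⟩ := exists_decomp K y
    simp only [TensorProduct.add_tmul, TensorProduct.tmul_add, map_add]
    exact add_mem
      (add_mem (Submodule.mem_sup_left (wedge₂_mem_wedge₂Deg hx₀ hy₀ rfl))
        (Submodule.mem_sup_right (wedge₂_mem_wedge₂Deg hx₁ hy₀ rfl)))
      (add_mem (Submodule.mem_sup_right (wedge₂_mem_wedge₂Deg hx₀ hy₁ rfl))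
        (Submodule.mem_sup_left (wedge₂_mem_wedge₂Deg hx₁ hy₁ rfl)))

variable (K P) in
/-- The super exterior square is a supermodule. -/
instance Wedge₂.supermodule : Supermodule K (Wedge₂ K P) where
  deg := wedge₂Deg K P
  isCompl := by
    constructor
    · rw [Submodule.disjoint_def]
      intro z h0 h1
      rw [← wedge₂Proj_same h0, wedge₂Proj_other (show (1 : ZMod 2) ≠ 0 by decide) h1]
    · rw [codisjoint_iff, wedge₂Deg_sup]

variable (K P) in
/-- The bilinear map `x, y ↦ x ∧ y` to `Λ²(P)`. -/
def wedge₂Bilin : P →ₗ[K] P →ₗ[K] Wedge₂ K P :=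
  (TensorProduct.mk K P P).compr₂ (wedgeRel₂ K P).mkQ

theorem wedge₂Bilin_apply (x y : P) : wedge₂Bilin K P x y = wedge₂ K x y := rfl

end Supermodule

variable [LieSuperalgebra K P]

theorem d₂_mem_deg {c : ZMod 2} {z : Wedge₂ K P} (hz : z ∈ wedge₂Deg K P c) :
    d₂ K P z ∈ deg K P c := by
  suffices h : wedge₂Deg K P c ≤ (deg K P c).comap (d₂ K P) from h hz
  refine Submodule.span_le.2 ?_
  rintro _ ⟨a, b, x, y, hx, hy, rfl, rfl⟩
  rw [SetLike.mem_coe, Submodule.mem_comap, d₂_wedge₂]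
  exact neg_mem (brk_mem hx hy)

theorem d₃_wedge₃_mem_deg {a b c : ZMod 2} {x y z : P} (hx : x ∈ deg K P a)
    (hy : y ∈ deg K P b) (hz : z ∈ deg K P c) :
    d₃ K P (wedge₃ K x y z) ∈ wedge₂Deg K P (a + b + c) := by
  rw [d₃_wedge₃ K P hx hy hz]
  exact sub_mem (add_mem
    (neg_mem (wedge₂_mem_wedge₂Deg (brk_mem hx hy) hz rfl))
    (zsmul_mem (wedge₂_mem_wedge₂Deg (brk_mem hx hz) hy (by abel)) _))
    (zsmul_mem (wedge₂_mem_wedge₂Deg (brk_mem hy hz) hx (by abel)) _)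

variable (K P) in
theorem isGraded_range_d₃ : IsGraded (LinearMap.range (d₃ K P)) := by
  rintro e _ ⟨t, rfl⟩
  induction t using wedge₃_induction with
  | hadd s t hs ht => rw [map_add, map_add]; exact add_mem hs ht
  | h0 => rw [map_zero, map_zero]; exact zero_mem _
  | h a b c x y z hx hy hz =>
    have h := d₃_wedge₃_mem_deg hx hy hz
    by_cases he : e = a + b + c
    · subst he
      rw [proj_same h]
      exact ⟨_, rfl⟩
    · rw [proj_other he h]
      exact zero_mem _

/-! ### The Lie superalgebra of two-chains modulo boundaries -/

variable (K P) in
/-- The quotient `Λ²(P) / d₃ Λ³(P)`. -/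
abbrev ChainQuot : Type v := Wedge₂ K P ⧸ LinearMap.range (d₃ K P)

/-- `Λ²(P) / d₃ Λ³(P)` is a supermodule, since `d₃` is even. -/
instance ChainQuot.supermodule : Supermodule K (ChainQuot K P) :=
  Supermodule.ofQuotient (LinearMap.range (d₃ K P)) (isGraded_range_d₃ K P)

namespace ChainQuot

theorem mem_deg {c : ZMod 2} {q : ChainQuot K P} :
    q ∈ deg K (ChainQuot K P) c ↔
      ∃ z ∈ wedge₂Deg K P c, (LinearMap.range (d₃ K P)).mkQ z = q := Iff.rfl

variable (K P) in
/-- The map `Λ²(P) / d₃ Λ³(P) → P` induced by `d₂`. -/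
def boundary : ChainQuot K P →ₗ[K] P :=
  (LinearMap.range (d₃ K P)).liftQ (d₂ K P) (by
    rintro _ ⟨t, rfl⟩
    exact d₂_d₃ t)

variable (K P) in
/-- The bilinear map sending `x`, `y` to the class of `x ∧ y` in `Λ²(P) / d₃ Λ³(P)`. -/
def wedge : P →ₗ[K] P →ₗ[K] ChainQuot K P :=
  (wedge₂Bilin K P).compr₂ (LinearMap.range (d₃ K P)).mkQ

theorem wedge_apply (x y : P) :
    wedge K P x y = (LinearMap.range (d₃ K P)).mkQ (wedge₂ K x y) := rfl

theorem boundary_mem {c : ZMod 2} {q : ChainQuot K P} (hq : q ∈ deg K (ChainQuot K P) c) :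
    boundary K P q ∈ deg K P c := by
  obtain ⟨z, hz, rfl⟩ := mem_deg.1 hq
  exact d₂_mem_deg hz

theorem boundary_wedge (x y : P) : boundary K P (wedge K P x y) = -brk K x y :=
  d₂_wedge₂ x y

theorem wedge_mem {a b : ZMod 2} {x y : P} (hx : x ∈ deg K P a) (hy : y ∈ deg K P b) :
    wedge K P x y ∈ deg K (ChainQuot K P) (a + b) :=
  mem_deg.2 ⟨_, wedge₂_mem_wedge₂Deg hx hy rfl, rfl⟩

theorem wedge_swap {a b : ZMod 2} {x y : P} (hx : x ∈ deg K P a) (hy : y ∈ deg K P b) :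
    wedge K P x y = -(sgn (a * b) • wedge K P y x) := by
  rw [wedge_apply, wedge₂_swap hx hy, map_neg, map_zsmul, wedge_apply]

theorem wedge_self {x : P} (hx : x ∈ deg K P 0) : wedge K P x x = 0 := by
  rw [wedge_apply, wedge₂_self hx, map_zero]

/-- The relation `d₃ (x ∧ y ∧ z) = 0`, in the shape of the Jacobi identity. -/
theorem wedge_brk {a b c : ZMod 2} {x y z : P} (hx : x ∈ deg K P a) (hy : y ∈ deg K P b)
    (hz : z ∈ deg K P c) :
    wedge K P (brk K x y) z =
      wedge K P x (brk K y z) - sgn (a * b) • wedge K P y (brk K x z) := by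
  have h : (LinearMap.range (d₃ K P)).mkQ (d₃ K P (wedge₃ K x y z)) = 0 :=
    (Submodule.Quotient.mk_eq_zero _).2 ⟨_, rfl⟩
  rw [d₃_wedge₃ K P hx hy hz] at h
  simp only [map_add, map_sub, map_neg, map_zsmul, ← wedge_apply] at h
  rw [wedge_swap hx (brk_mem hy hz), wedge_swap hy (brk_mem hx hz)]
  rw [← sub_eq_zero, ← neg_eq_zero, ← h]
  rcases zmod_two_cases a with rfl | rfl <;> rcases zmod_two_cases b with rfl | rfl <;>
    rcases zmod_two_cases c with rfl | rfl <;> simp [sgn_zero, sgn_one, one_add_one_zmod] <;> abel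

/-- The Lie superalgebra structure `[u, v] = d₂ u ∧ d₂ v` on `Λ²(P) / d₃ Λ³(P)`. Since
`d₂ [u, v] = -[d₂ u, d₂ v]`, its Jacobi identity is `wedge_brk`. -/
instance lieSuperalgebra : LieSuperalgebra K (ChainQuot K P) where
  toSupermodule := ChainQuot.supermodule
  brk := (wedge K P).compl₁₂ (boundary K P) (boundary K P)
  brk_mem hx hy := wedge_mem (boundary_mem hx) (boundary_mem hy)
  skew {_ _ q r} hx hy := by
    change wedge K P (boundary K P q) (boundary K P r) =
      -(_ • wedge K P (boundary K P r) (boundary K P q))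
    exact wedge_swap (boundary_mem hx) (boundary_mem hy)
  jacobi {a b _ q r s} hx hy hz := by
    change wedge K P (boundary K P q)
        (boundary K P (wedge K P (boundary K P r) (boundary K P s))) =
      wedge K P (boundary K P (wedge K P (boundary K P q) (boundary K P r))) (boundary K P s) +
        sgn (a * b) • wedge K P (boundary K P r)
          (boundary K P (wedge K P (boundary K P q) (boundary K P s)))
    simp only [boundary_wedge, map_neg, LinearMap.neg_apply, smul_neg,
      wedge_brk (boundary_mem hx) (boundary_mem hy) (boundary_mem hz)]
    abel
  brk_self {q} hx := by
    change wedge K P (boundary K P q) (boundary K P q) = 0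
    exact wedge_self (boundary_mem hx)

theorem brk_eq (q r : ChainQuot K P) :
    brk K q r = wedge K P (boundary K P q) (boundary K P r) := rfl

end ChainQuot

end Grading

/-! ### The comparison map from the non-abelian exterior product -/

namespace GradedIdeal

variable {K : Type u} {P : Type v} [CommRing K] [AddCommGroup P] [Module K P]
  [LieSuperalgebra K P] (M : GradedIdeal K P)

/-- The map on symbols that induces `P ⊗ M → Λ²(P) / d₃ Λ³(P)`. -/
def chainSymbol (s : TensorSymbol K P M.toSubmodule) : ChainQuot K P :=
  ChainQuot.wedge K P (s.m : P) ((s.n : M.toSubmodule) : P)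

theorem chainSymbol_mem (s : TensorSymbol K P M.toSubmodule) :
    M.chainSymbol s ∈ deg K (ChainQuot K P) (s.a + s.b) :=
  ChainQuot.wedge_mem s.m.2 (M.mem_deg.1 s.n.2)

/-- The assignment `p ⊗ m ↦ p ∧ m` respects the relations of the non-abelian tensor product. -/
theorem tensorIdeal_le_ker_chainSymbol :
    tensorIdeal ((CrossedModule.self K P).actionOn (CrossedModule.ofIdeal M))
        ((CrossedModule.ofIdeal M).actionOn (CrossedModule.self K P)) ≤
      LinearMap.ker (freeLift M.chainSymbol) := by
  have hs := M.chainSymbol_mem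
  refine tensorIdeal_le _ _ ?_ ?_
  · intro t ht
    rw [LinearMap.mem_ker]
    cases ht with
    | smul_left r hm hn => simp [freeLift_gen, chainSymbol]
    | smul_right r hm hn => simp [freeLift_gen, chainSymbol]
    | add_left hm hm' hn => simp [freeLift_gen, chainSymbol]
    | add_right hm hn hn' => simp [freeLift_gen, chainSymbol]
    | brk_left hm hm' hn =>
      simp only [map_sub, map_zsmul, freeLift_gen, chainSymbol]
      rw [ChainQuot.wedge_brk hm hm' (M.mem_deg.1 hn)]
      exact sub_self _
    | @brk_right a b b' p m m' hm hn hn' =>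
      simp only [map_sub, map_zsmul, freeLift_gen, chainSymbol]
      have hn₁ := M.mem_deg.1 hn
      have hn₂ := M.mem_deg.1 hn'
      change ChainQuot.wedge K P p (brk K (m : P) (m' : P)) -
        (sgn (b' * (a + b)) • ChainQuot.wedge K P (brk K (m' : P) p) (m : P) -
          sgn (a * b) • ChainQuot.wedge K P (brk K (m : P) p) (m' : P)) = 0
      -- up to signs, the relation is `d₃ (p ∧ m ∧ m') = 0`
      have h := ChainQuot.wedge_brk hm hn₁ hn₂
      rw [eq_sub_iff_add_eq] at h
      rw [← h, skew hn₂ hm, skew hn₁ hm]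
      simp only [map_neg, map_zsmul, LinearMap.neg_apply, LinearMap.smul_apply]
      rw [ChainQuot.wedge_swap (brk_mem hm hn₂) hn₁]
      rcases zmod_two_cases a with rfl | rfl <;> rcases zmod_two_cases b with rfl | rfl <;>
        rcases zmod_two_cases b' with rfl | rfl <;>
        simp [sgn_zero, sgn_one, one_add_one_zmod] <;> abel
    | brk_gen hm hn hm' hn' =>
      simp only [map_sub, map_neg, map_zsmul, freeLift_mul, freeLift_gen, chainSymbol,
        ChainQuot.brk_eq, ChainQuot.boundary_wedge, LinearMap.neg_apply, neg_neg]
      rw [skew hm (M.mem_deg.1 hn)]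
      simp only [map_neg, map_zsmul, LinearMap.neg_apply, LinearMap.smul_apply]
      exact sub_self _
    | skew hx hy =>
      simp only [map_sub, map_neg, map_zsmul, freeLift_mul]
      rw [skew (freeLift_mem _ hs hx) (freeLift_mem _ hs hy), sub_self]
    | jacobi hx hy hz =>
      simp only [map_sub, map_add, map_zsmul, freeLift_mul]
      rw [jacobi (freeLift_mem _ hs hx) (freeLift_mem _ hs hy) (freeLift_mem _ hs hz), sub_self]
    | brk_self hx =>
      rw [freeLift_mul, brk_self (freeLift_mem _ hs hx)]
  · intro x t ht
    rw [LinearMap.mem_ker] at ht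
    simp [LinearMap.mem_ker, freeLift_mul, ht]

/-- The homomorphism `P ⊗ M → Λ²(P) / d₃ Λ³(P)` on the non-abelian tensor product that sends
`p ⊗ m` to the class of `p ∧ m`. -/
def tensorToChain :
    CrossedTensor (CrossedModule.self K P) (CrossedModule.ofIdeal M) →ₗ[K] ChainQuot K P :=
  (tensorIdeal _ _).liftQ (freeLift M.chainSymbol) M.tensorIdeal_le_ker_chainSymbol

theorem tensorToChain_tmulHom {a b : ZMod 2} {p : P} {m : M.toSubmodule} (hp : p ∈ deg K P a)
    (hm : m ∈ deg K M.toSubmodule b) :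
    M.tensorToChain (NATensor.tmulHom _ _ hp hm) = ChainQuot.wedge K P p (m : P) :=
  freeLift_gen _ hp hm

theorem square_le_ker_tensorToChain :
    square (CrossedModule.self K P) (CrossedModule.ofIdeal M) ≤
      LinearMap.ker M.tensorToChain := by
  refine Submodule.span_le.2 ?_
  rintro _ (⟨a, b, a', b', p, p', m, m', hp, hm, hp', hm', e, e', rfl⟩ | ⟨p, m, hp, hm, e, rfl⟩)
  · rw [SetLike.mem_coe, LinearMap.mem_ker, map_add, map_zsmul, tensorToChain_tmulHom,
      tensorToChain_tmulHom]
    change p = (m' : P) at e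
    change p' = (m : P) at e'
    have hm₁ := M.mem_deg.1 hm
    have hm₂ := M.mem_deg.1 hm'
    rw [← e, e']
    rw [← e] at hm₂
    rw [e'] at hp'
    by_cases h : a = b'
    · by_cases h' : b = a'
      · subst h h'
        rw [ChainQuot.wedge_swap hp hm₁, mul_comm, neg_add_cancel]
      · simp [eq_zero_of_mem_deg h' hm₁ hp']
    · simp [eq_zero_of_mem_deg h hp hm₂]
  · rw [SetLike.mem_coe, LinearMap.mem_ker, tensorToChain_tmulHom]
    change p = (m : P) at e
    rw [← e]
    exact ChainQuot.wedge_self hp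

/-- The map `P ∧ M → Λ²(P) / d₃ Λ³(P)` that sends `p ∧ m` to the class of `p ∧ m`. -/
def extToChain : M.Ext →ₗ[K] ChainQuot K P :=
  (square _ _).liftQ M.tensorToChain M.square_le_ker_tensorToChain

theorem extToChain_toExt (t : P ⊗[K] M.toSubmodule) :
    M.extToChain (M.toExt t) = (LinearMap.range (d₃ K P)).mkQ (M.toWedge₂ t) := by
  induction t using TensorProduct.induction_on with
  | zero => simp
  | add s t hs ht => simp only [map_add, hs, ht]
  | tmul p m =>
    have hs : (Finset.univ : Finset (ZMod 2)) = {0, 1} := by decide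
    have h01 : (0 : ZMod 2) ≠ 1 := by decide
    change M.tensorToChain (NATensor.tmul _ _ p m) = ChainQuot.wedge K P p (m : P)
    simp only [NATensor.tmul, LinearMap.mk₂_apply, hs, Finset.sum_pair h01, map_add,
      tensorToChain_tmulHom]
    conv_rhs => rw [← proj_zero_add_proj_one (K := K) p, ← proj_zero_add_proj_one (K := K) m]
    simp only [Submodule.coe_add, map_add, LinearMap.add_apply]
    abel

theorem extToChain_mem {a : ZMod 2} {q : M.Ext} (hq : q ∈ ExteriorProduct.deg _ _ a) :
    M.extToChain q ∈ deg K (ChainQuot K P) a := by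
  obtain ⟨_, ⟨x, hx, rfl⟩, rfl⟩ := hq
  exact freeLift_mem _ M.chainSymbol_mem hx

end GradedIdeal

/-! ### Generation of the non-abelian tensor and exterior products -/

section Generation

variable {K : Type u} {M : Type v} {N : Type w} [CommRing K]
  [AddCommGroup M] [Module K M] [LieSuperalgebra K M]
  [AddCommGroup N] [Module K N] [LieSuperalgebra K N]
  (α : LieSuperAction K M N) (β : LieSuperAction K N M)

theorem NATensor.brk_tmulHom {a b a' b' : ZMod 2} {m m' : M} {n n' : N} (hm : m ∈ deg K M a)
    (hn : n ∈ deg K N b) (hm' : m' ∈ deg K M a') (hn' : n' ∈ deg K N b') :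
    brk K (NATensor.tmulHom α β hm hn) (NATensor.tmulHom α β hm' hn') =
      -(sgn (a * b) • NATensor.tmulHom α β (β.act_mem hn hm) (α.act_mem hm' hn')) :=
  NATensor.eq_of_rel (TensorRel.brk_gen hm hn hm' hn')

/-- As a module, the non-abelian tensor product is spanned by the symbols `m ⊗ n`: the bracket of
two symbols is again a symbol up to sign. -/
theorem NATensor.span_tmulHom :
    Submodule.span K {t | ∃ (a b : ZMod 2) (m : M) (n : N) (hm : m ∈ deg K M a)
      (hn : n ∈ deg K N b), t = NATensor.tmulHom α β hm hn} = ⊤ := by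
  set S : Set (NATensor α β) := {t | ∃ (a b : ZMod 2) (m : M) (n : N) (hm : m ∈ deg K M a)
      (hn : n ∈ deg K N b), t = NATensor.tmulHom α β hm hn} with hS
  have hbrk : ∀ x ∈ Submodule.span K S, ∀ y ∈ Submodule.span K S,
      brk K x y ∈ Submodule.span K S := by
    intro x hx y hy
    refine LinearMap.BilinMap.apply_apply_mem_of_mem_span (Submodule.span K S) S S (brk K) ?_
      x y hx hy
    rintro _ ⟨a, b, m, n, hm, hn, rfl⟩ _ ⟨a', b', m', n', hm', hn', rfl⟩
    rw [NATensor.brk_tmulHom]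
    refine neg_mem (zsmul_mem (Submodule.subset_span ?_) _)
    exact ⟨_, _, _, _, β.act_mem hn hm, α.act_mem hm' hn', rfl⟩
  have hword : ∀ w : FreeMagma (TensorSymbol K M N),
      (tensorIdeal α β).mkQ (MonoidAlgebra.single w 1) ∈ Submodule.span K S := by
    intro w
    induction w with
    | ih1 s => exact Submodule.subset_span ⟨s.a, s.b, s.m, s.n, s.m.2, s.n.2, rfl⟩
    | ih2 v w hv hw =>
      have h : (MonoidAlgebra.single (v * w) 1 : FreeTensor K M N) =
          MonoidAlgebra.single v 1 * MonoidAlgebra.single w 1 := by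
        rw [MonoidAlgebra.single_mul_single, one_mul]
      rw [h]
      exact hbrk _ hv _ hw
  rw [eq_top_iff]
  rintro q -
  obtain ⟨x, rfl⟩ := (tensorIdeal α β).mkQ_surjective q
  induction x using MonoidAlgebra.induction_linear with
  | zero => rw [map_zero]; exact zero_mem _
  | add x y hx hy => rw [map_add]; exact add_mem hx hy
  | single w r =>
    have h : (MonoidAlgebra.single w r : FreeTensor K M N) = r • MonoidAlgebra.single w 1 := by
      simp
    rw [h, map_smul]
    exact Submodule.smul_mem _ _ (hword w)

theorem NATensor.tmul_of_mem {a b : ZMod 2} {m : M} {n : N} (hm : m ∈ deg K M a)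
    (hn : n ∈ deg K N b) : NATensor.tmul α β m n = NATensor.tmulHom α β hm hn := by
  have h0l : ∀ {c d : ZMod 2} {x : M} {y : N} (hx : x ∈ deg K M c) (hy : y ∈ deg K N d),
      x = 0 → NATensor.tmulHom α β hx hy = 0 := by
    rintro c d x y hx hy rfl
    exact (NATensor.tmulHom_congr hx (Submodule.smul_mem _ 0 hx) hy hy (zero_smul K _).symm
      rfl).trans ((NATensor.smul_tmulHom 0 hx hy).trans (zero_smul K _))
  have h0r : ∀ {c d : ZMod 2} {x : M} {y : N} (hx : x ∈ deg K M c) (hy : y ∈ deg K N d),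
      y = 0 → NATensor.tmulHom α β hx hy = 0 := by
    rintro c d x y hx hy rfl
    exact (NATensor.tmulHom_congr hx hx hy (Submodule.smul_mem _ 0 hy) rfl
      (zero_smul K _).symm).trans ((NATensor.tmulHom_smul 0 hx hy).trans (zero_smul K _))
  simp only [NATensor.tmul, LinearMap.mk₂_apply]
  rw [Finset.sum_eq_single a, Finset.sum_eq_single b]
  · exact NATensor.tmulHom_congr _ _ _ _ (proj_same hm) (proj_same hn)
  · exact fun d _ hd => h0r _ _ (proj_other hd hn)
  · simp
  · exact fun c _ hc => Finset.sum_eq_zero fun d _ => h0l _ _ (proj_other hc hm)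
  · simp

end Generation

namespace GradedIdeal

variable {K : Type u} {P : Type v} [CommRing K] [AddCommGroup P] [Module K P]
  [LieSuperalgebra K P] (M : GradedIdeal K P)

/-- Every element of `P ∧ M` is a sum of elements `p ∧ m`; the bracket is not needed to generate. -/
theorem toExt_surjective : Function.Surjective M.toExt := by
  have h : (⊤ : Submodule K (CrossedTensor (CrossedModule.self K P)
      (CrossedModule.ofIdeal M))) ≤ (LinearMap.range M.toExt).comap
      (square (CrossedModule.self K P) (CrossedModule.ofIdeal M)).mkQ := by
    rw [← NATensor.span_tmulHom]
    refine Submodule.span_le.2 ?_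
    rintro _ ⟨a, b, p, m, hp, hm, rfl⟩
    refine ⟨p ⊗ₜ[K] m, ?_⟩
    rw [← NATensor.tmul_of_mem]
    rfl
  intro q
  obtain ⟨x, rfl⟩ := Submodule.mkQ_surjective _ q
  exact h (Submodule.mem_top : x ∈ ⊤)

/-! ### The projection on chains -/

theorem toWedge₂_tmul (p : P) (m : M.toSubmodule) :
    M.toWedge₂ (p ⊗ₜ[K] m) = wedge₂ K p (m : P) := rfl

theorem wedge₂_mem_range_toWedge₂_left {m : P} (hm : m ∈ M.toSubmodule) (p : P) :
    wedge₂ K m p ∈ LinearMap.range M.toWedge₂ := by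
  have key : ∀ a b : ZMod 2, wedge₂ K (proj K a m) (proj K b p) ∈
      LinearMap.range M.toWedge₂ := by
    intro a b
    rw [wedge₂_swap (proj_mem a m) (proj_mem b p)]
    refine neg_mem (zsmul_mem ?_ _)
    exact ⟨proj K b p ⊗ₜ[K] ⟨proj K a m, M.graded a m hm⟩, rfl⟩
  rw [← wedge₂Bilin_apply, ← proj_zero_add_proj_one (K := K) m,
    ← proj_zero_add_proj_one (K := K) p]
  simp only [map_add, LinearMap.add_apply]
  exact add_mem (add_mem (key _ _) (key _ _)) (add_mem (key _ _) (key _ _))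

theorem wedge₂Map_toWedge₂ (t : P ⊗[K] M.toSubmodule) :
    wedge₂Map M.mkHom (M.toWedge₂ t) = 0 := by
  induction t using TensorProduct.induction_on with
  | zero => simp
  | add s t hs ht => simp only [map_add, hs, ht, add_zero]
  | tmul p m =>
    have h : M.mkHom.toLinearMap (m : P) = 0 := (Submodule.Quotient.mk_eq_zero _).2 m.2
    rw [toWedge₂_tmul, wedge₂Map_wedge₂, h, ← wedge₂Bilin_apply, map_zero]

theorem wedgeRel₂_quot_le :
    wedgeRel₂ K M.Quot ≤
      (wedgeRel₂ K P).map (TensorProduct.map M.toSubmodule.mkQ M.toSubmodule.mkQ) := by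
  refine Submodule.span_le.2 ?_
  rintro _ (⟨a, b, _, _, ⟨x, hx, rfl⟩, ⟨y, hy, rfl⟩, rfl⟩ | ⟨_, ⟨x, hx, rfl⟩, rfl⟩)
  · exact ⟨_, Submodule.subset_span (Or.inl ⟨a, b, x, y, hx, hy, rfl⟩), by simp⟩
  · exact ⟨_, Submodule.subset_span (Or.inr ⟨x, hx, rfl⟩), by simp⟩

/-- The kernel of `Λ²(P) → Λ²(P / M)` is spanned by the elements `p ∧ m`. -/
theorem ker_wedge₂Map_mkHom :
    LinearMap.ker (wedge₂Map M.mkHom) = LinearMap.range M.toWedge₂ := by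
  apply le_antisymm
  · intro z hz
    obtain ⟨t, rfl⟩ := (wedgeRel₂ K P).mkQ_surjective z
    have ht : TensorProduct.map M.toSubmodule.mkQ M.toSubmodule.mkQ t ∈ wedgeRel₂ K M.Quot :=
      (Submodule.Quotient.mk_eq_zero _).1 hz
    obtain ⟨r, hr, hrt⟩ := M.wedgeRel₂_quot_le ht
    have hker : t - r ∈ LinearMap.ker
        (TensorProduct.map M.toSubmodule.mkQ M.toSubmodule.mkQ) := by
      rw [LinearMap.mem_ker, map_sub, hrt, sub_self]
    have hex : Function.Exact M.toSubmodule.subtype M.toSubmodule.mkQ :=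
      LinearMap.exact_subtype_mkQ _
    rw [TensorProduct.map_ker hex M.toSubmodule.mkQ_surjective hex
      M.toSubmodule.mkQ_surjective] at hker
    have hle : LinearMap.range (LinearMap.lTensor P M.toSubmodule.subtype) ⊔
        LinearMap.range (LinearMap.rTensor P M.toSubmodule.subtype) ≤
        (LinearMap.range M.toWedge₂).comap (wedgeRel₂ K P).mkQ := by
      refine sup_le ?_ ?_
      · rintro _ ⟨s, rfl⟩
        exact ⟨s, rfl⟩
      · rintro _ ⟨s, rfl⟩
        induction s using TensorProduct.induction_on with
        | zero => rw [map_zero]; exact zero_mem _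
        | add s t hs ht => rw [map_add]; exact add_mem hs ht
        | tmul m p => exact M.wedge₂_mem_range_toWedge₂_left m.2 p
    have h := hle hker
    have hr0 : (wedgeRel₂ K P).mkQ r = 0 := (Submodule.Quotient.mk_eq_zero _).2 hr
    rwa [Submodule.mem_comap, map_sub, hr0, sub_zero] at h
  · rintro _ ⟨t, rfl⟩
    exact M.wedge₂Map_toWedge₂ t

theorem wedge₂Map_mkHom_surjective : Function.Surjective (wedge₂Map M.mkHom) := by
  intro w
  obtain ⟨t, rfl⟩ := (wedgeRel₂ K M.Quot).mkQ_surjective w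
  obtain ⟨s, rfl⟩ := TensorProduct.map_surjective M.toSubmodule.mkQ_surjective
    M.toSubmodule.mkQ_surjective t
  exact ⟨(wedgeRel₂ K P).mkQ s, rfl⟩

theorem exists_wedge₂Deg_lift {c : ZMod 2} {w : Wedge₂ K M.Quot}
    (hw : w ∈ wedge₂Deg K M.Quot c) : ∃ z ∈ wedge₂Deg K P c, wedge₂Map M.mkHom z = w := by
  suffices h : wedge₂Deg K M.Quot c ≤ (wedge₂Deg K P c).map (wedge₂Map M.mkHom) from h hw
  refine Submodule.span_le.2 ?_
  rintro _ ⟨a, b, _, _, ⟨x, hx, rfl⟩, ⟨y, hy, rfl⟩, h, rfl⟩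
  exact ⟨_, wedge₂_mem_wedge₂Deg hx hy h, rfl⟩

/-- Every boundary in `Λ²(P / M)` lifts to a boundary in `Λ²(P)`. -/
theorem exists_wedge₂Map_d₃_eq (s : Wedge₃ K M.Quot) :
    ∃ t, wedge₂Map M.mkHom (d₃ K P t) = d₃ K M.Quot s := by
  induction s using wedge₃_induction with
  | hadd s s' hs hs' =>
    obtain ⟨t, ht⟩ := hs
    obtain ⟨t', ht'⟩ := hs'
    exact ⟨t + t', by rw [map_add, map_add, map_add, ht, ht']⟩
  | h0 => exact ⟨0, by simp⟩
  | h a b c x y z hx hy hz =>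
    obtain ⟨x, hx', rfl⟩ := M.mem_deg_quot.1 hx
    obtain ⟨y, hy', rfl⟩ := M.mem_deg_quot.1 hy
    obtain ⟨z, hz', rfl⟩ := M.mem_deg_quot.1 hz
    refine ⟨wedge₃ K x y z, ?_⟩
    rw [d₃_wedge₃ K P hx' hy' hz', d₃_wedge₃ K M.Quot hx hy hz]
    simp only [map_add, map_sub, map_neg, map_zsmul, wedge₂Map_wedge₂, M.mkHom.map_brk]
    rfl

/-- A chain on `P` that becomes a boundary on `P / M` is the sum of a boundary and of elements
`p ∧ m`. -/
theorem exists_eq_d₃_add_toWedge₂ {z : Wedge₂ K P}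
    (hz : wedge₂Map M.mkHom z ∈ LinearMap.range (d₃ K M.Quot)) :
    ∃ s t, z = d₃ K P s + M.toWedge₂ t := by
  obtain ⟨u, hu⟩ := hz
  obtain ⟨s, hs⟩ := M.exists_wedge₂Map_d₃_eq u
  have h : z - d₃ K P s ∈ LinearMap.ker (wedge₂Map M.mkHom) := by
    rw [LinearMap.mem_ker, map_sub, hs, hu, sub_self]
  rw [ker_wedge₂Map_mkHom] at h
  obtain ⟨t, ht⟩ := h
  exact ⟨s, t, by rw [ht, add_sub_cancel]⟩

theorem d₂_toWedge₂_tmul (p : P) (m : M.toSubmodule) :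
    d₂ K P (M.toWedge₂ (p ⊗ₜ[K] m)) = -brk K p (m : P) := d₂_wedge₂ p (m : P)

/-- The image of the elements `p ∧ m` under `d₂` is `[P, M]`. -/
theorem range_d₂_comp_toWedge₂ :
    LinearMap.range (d₂ K P ∘ₗ M.toWedge₂) = brkSpan ⊤ M.toSubmodule := by
  apply le_antisymm
  · rintro _ ⟨t, rfl⟩
    induction t using TensorProduct.induction_on with
    | zero => rw [map_zero]; exact zero_mem _
    | add s t hs ht => rw [map_add]; exact add_mem hs ht
    | tmul p m =>
      rw [LinearMap.comp_apply, d₂_toWedge₂_tmul]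
      exact neg_mem (Submodule.subset_span ⟨p, trivial, m, m.2, rfl⟩)
  · refine Submodule.span_le.2 ?_
    rintro _ ⟨p, -, m, hm, rfl⟩
    refine ⟨-(p ⊗ₜ[K] ⟨m, hm⟩), ?_⟩
    rw [map_neg, LinearMap.comp_apply, d₂_toWedge₂_tmul, neg_neg]

theorem d₂_mem_iff {z : Wedge₂ K P} :
    d₂ K P z ∈ M.toSubmodule ↔ wedge₂Map M.mkHom z ∈ LinearMap.ker (d₂ K M.Quot) := by
  rw [LinearMap.mem_ker, d₂_wedge₂Map]
  exact (Submodule.Quotient.mk_eq_zero _).symm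

end GradedIdeal

/-! ### Homology classes -/

section Homology

variable {K : Type u} {P : Type v} [CommRing K] [AddCommGroup P] [Module K P]
  [LieSuperalgebra K P]

theorem H₁.mk_eq_zero {x : P} : H₁.mk K x = 0 ↔ x ∈ LinearMap.range (d₂ K P) :=
  Submodule.Quotient.mk_eq_zero _

theorem H₁.mk_eq_mk {x y : P} : H₁.mk K x = H₁.mk K y ↔ x - y ∈ LinearMap.range (d₂ K P) :=
  Submodule.Quotient.eq _

theorem H₁.mk_surjective (q : H₁ K P) : ∃ x : P, H₁.mk K x = q := by
  obtain ⟨x, rfl⟩ := Submodule.mkQ_surjective _ q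
  exact ⟨x, rfl⟩

theorem H₂.mk_eq_zero {z : Wedge₂ K P} (hz : z ∈ LinearMap.ker (d₂ K P)) :
    H₂.mk K z hz = 0 ↔ z ∈ LinearMap.range (d₃ K P) :=
  Submodule.Quotient.mk_eq_zero _

theorem H₂.mk_eq_mk {z w : Wedge₂ K P} (hz : z ∈ LinearMap.ker (d₂ K P))
    (hw : w ∈ LinearMap.ker (d₂ K P)) :
    H₂.mk K z hz = H₂.mk K w hw ↔ z - w ∈ LinearMap.range (d₃ K P) :=
  Submodule.Quotient.eq _

theorem H₂.mk_surjective (q : H₂ K P) : ∃ z hz, H₂.mk K (P := P) z hz = q := by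
  obtain ⟨⟨z, hz⟩, rfl⟩ := Submodule.mkQ_surjective _ q
  exact ⟨z, hz, rfl⟩

variable (K P) in
/-- The class map `Ker d₂ → H₂(P)`. -/
def H₂.mkLin : LinearMap.ker (d₂ K P) →ₗ[K] H₂ K P := Submodule.mkQ _

theorem H₂.mem_deg {a : ZMod 2} {q : H₂ K P} :
    q ∈ H₂.deg K P a ↔ ∃ z hz, z ∈ wedge₂Deg K P a ∧ H₂.mk K z hz = q := by
  constructor
  · rintro ⟨⟨z, hz⟩, hz', rfl⟩
    exact ⟨z, hz, hz', rfl⟩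
  · rintro ⟨z, hz, hz', rfl⟩
    exact ⟨⟨z, hz⟩, hz', rfl⟩

theorem H₁.mem_deg {a : ZMod 2} {q : H₁ K P} :
    q ∈ H₁.deg K P a ↔ ∃ x ∈ SuperLie.deg K P a, H₁.mk K x = q := by
  constructor
  · rintro ⟨⟨x, _⟩, hx, rfl⟩
    exact ⟨x, hx, rfl⟩
  · rintro ⟨x, hx, rfl⟩
    exact ⟨⟨x, rfl⟩, hx, rfl⟩

variable {Q : Type w} [AddCommGroup Q] [Module K Q] [LieSuperalgebra K Q]

theorem wedge₂Map_mem_ker (f : LieSuperHom K P Q) {z : Wedge₂ K P}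
    (hz : z ∈ LinearMap.ker (d₂ K P)) : wedge₂Map f z ∈ LinearMap.ker (d₂ K Q) := by
  rw [LinearMap.mem_ker] at hz ⊢
  rw [d₂_wedge₂Map, hz, map_zero]

theorem H₂.map_mk (f : LieSuperHom K P Q) {z : Wedge₂ K P} (hz : z ∈ LinearMap.ker (d₂ K P)) :
    H₂.map f (H₂.mk K z hz) = H₂.mk K (wedge₂Map f z) (wedge₂Map_mem_ker f hz) := rfl

theorem H₁.map_mk (f : LieSuperHom K P Q) (x : P) :
    H₁.map f (H₁.mk K x) = H₁.mk K (f.toLinearMap x) := rfl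

theorem wedge₂Map_mem_deg (f : LieSuperHom K P Q) {a : ZMod 2} {z : Wedge₂ K P}
    (hz : z ∈ wedge₂Deg K P a) : wedge₂Map f z ∈ wedge₂Deg K Q a := by
  suffices h : wedge₂Deg K P a ≤ (wedge₂Deg K Q a).comap (wedge₂Map f) from h hz
  refine Submodule.span_le.2 ?_
  rintro _ ⟨b, c, x, y, hx, hy, h, rfl⟩
  exact wedge₂_mem_wedge₂Deg (f.map_deg b x hx) (f.map_deg c y hy) h

theorem H₂.isEven_map (f : LieSuperHom K P Q) :
    IsEven (H₂.deg K P) (H₂.deg K Q) (H₂.map f) := by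
  intro a q hq
  obtain ⟨z, hz, hz', rfl⟩ := H₂.mem_deg.1 hq
  exact H₂.mem_deg.2 ⟨_, wedge₂Map_mem_ker f hz, wedge₂Map_mem_deg f hz', rfl⟩

theorem H₁.isEven_map (f : LieSuperHom K P Q) :
    IsEven (H₁.deg K P) (H₁.deg K Q) (H₁.map f) := by
  intro a q hq
  obtain ⟨x, hx, rfl⟩ := H₁.mem_deg.1 hq
  exact H₁.mem_deg.2 ⟨_, f.map_deg a x hx, rfl⟩

end Homology

/-! ### The maps of the exact sequence -/

namespace GradedIdeal

variable {K : Type u} {P : Type v} [CommRing K] [AddCommGroup P] [Module K P]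
  [LieSuperalgebra K P] (M : GradedIdeal K P)

theorem toExt_mem_ker_iff {t : P ⊗[K] M.toSubmodule} :
    M.toExt t ∈ LinearMap.ker M.extToBase ↔ M.toWedge₂ t ∈ LinearMap.ker (d₂ K P) := by
  rw [LinearMap.mem_ker, LinearMap.mem_ker, d₂_toWedge₂, neg_eq_zero]

/-- The map `Ker (P ∧ M → P) → H₂(P)` sending `∑ p ∧ m` to the class of the cycle `∑ p ∧ m`. It is
well defined since `P ∧ M → Λ²(P) / d₃ Λ³(P)` is. -/
theorem exists_kerToH₂ : ∃ f : LinearMap.ker M.extToBase →ₗ[K] H₂ K P,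
    ∀ (t : P ⊗[K] M.toSubmodule) (ht : M.toExt t ∈ LinearMap.ker M.extToBase)
      (hz : M.toWedge₂ t ∈ LinearMap.ker (d₂ K P)),
      f ⟨M.toExt t, ht⟩ = H₂.mk K (M.toWedge₂ t) hz := by
  let g : LinearMap.ker (d₂ K P ∘ₗ M.toWedge₂) →ₗ[K] LinearMap.ker M.extToBase :=
    M.toExt.restrict fun t ht => M.toExt_mem_ker_iff.2 ht
  let h : LinearMap.ker (d₂ K P ∘ₗ M.toWedge₂) →ₗ[K] H₂ K P :=
    H₂.mkLin K P ∘ₗ M.toWedge₂.restrict fun t ht => ht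
  have hg : Function.Surjective g := by
    rintro ⟨q, hq⟩
    obtain ⟨t, rfl⟩ := M.toExt_surjective q
    exact ⟨⟨t, M.toExt_mem_ker_iff.1 hq⟩, rfl⟩
  have hk : LinearMap.ker g ≤ LinearMap.ker h := by
    rintro ⟨t, ht⟩ htg
    have h0 : M.toExt t = 0 := congrArg Subtype.val htg
    refine (H₂.mk_eq_zero (K := K) (P := P) ht).2 ((Submodule.Quotient.mk_eq_zero _).1 ?_)
    exact (M.extToChain_toExt t).symm.trans (by rw [h0, map_zero])
  obtain ⟨f, hf⟩ := exists_factor_of_surjective hg hk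
  exact ⟨f, fun t ht hz => hf ⟨t, hz⟩⟩

/-- The connecting map `H₂(P / M) → M / [P, M]`: a cycle on `P / M` is lifted to a chain `z` on `P`,
and `-d₂ z` lies in `M`. -/
theorem exists_connecting : ∃ δ : H₂ K M.Quot →ₗ[K] M.Coinv,
    ∀ (z : Wedge₂ K P) (hz : wedge₂Map M.mkHom z ∈ LinearMap.ker (d₂ K M.Quot))
      (m : M.toSubmodule), (m : P) = -d₂ K P z →
      δ (H₂.mk K (wedge₂Map M.mkHom z) hz) = Submodule.Quotient.mk m := by
  let S : Submodule K (Wedge₂ K P) := M.toSubmodule.comap (d₂ K P)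
  let g : S →ₗ[K] H₂ K M.Quot :=
    H₂.mkLin K M.Quot ∘ₗ (wedge₂Map M.mkHom).restrict fun z hz => M.d₂_mem_iff.1 hz
  let h : S →ₗ[K] M.Coinv :=
    Submodule.mkQ _ ∘ₗ (-d₂ K P).restrict fun z hz => neg_mem (Submodule.mem_comap.1 hz)
  have hg : Function.Surjective g := by
    intro q
    obtain ⟨w, hw, rfl⟩ := H₂.mk_surjective q
    obtain ⟨z, rfl⟩ := M.wedge₂Map_mkHom_surjective w
    exact ⟨⟨z, M.d₂_mem_iff.2 hw⟩, rfl⟩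
  have hk : LinearMap.ker g ≤ LinearMap.ker h := by
    rintro ⟨z, hz⟩ hzg
    obtain ⟨s, t, rfl⟩ := M.exists_eq_d₃_add_toWedge₂ ((H₂.mk_eq_zero _).1 hzg)
    refine (Submodule.Quotient.mk_eq_zero _).2 ?_
    change -d₂ K P (d₃ K P s + M.toWedge₂ t) ∈ brkSpan ⊤ M.toSubmodule
    rw [map_add, d₂_d₃, zero_add, ← range_d₂_comp_toWedge₂]
    exact neg_mem ⟨t, rfl⟩
  obtain ⟨δ, hδ⟩ := exists_factor_of_surjective hg hk
  refine ⟨δ, fun z hz m hm => ?_⟩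
  refine (hδ ⟨z, M.d₂_mem_iff.2 hz⟩).trans (congrArg (Submodule.mkQ _) (Subtype.ext ?_))
  exact hm.symm

/-- The map `M / [P, M] → H₁(P)` induced by the inclusion. -/
def coinvToH₁ : M.Coinv →ₗ[K] H₁ K P :=
  Submodule.liftQ _ (Submodule.mkQ _ ∘ₗ
    (M.toSubmodule.subtype.codRestrict (LinearMap.ker (d₁ K P)) fun _ => rfl)) (by
    intro m hm
    have hm' : (m : P) ∈ brkSpan ⊤ M.toSubmodule := hm
    rw [← range_d₂_comp_toWedge₂] at hm'
    obtain ⟨t, ht⟩ := hm'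
    exact H₁.mk_eq_zero.2 ⟨M.toWedge₂ t, ht⟩)

theorem coinvToH₁_mk (m : M.toSubmodule) :
    M.coinvToH₁ (Submodule.Quotient.mk m) = H₁.mk K (m : P) := rfl

end GradedIdeal

end SuperLie

end

open SuperLie
theorem mainTheorem5 {K : Type*} [CommRing K] {P : Type*} [AddCommGroup P] [Module K P]
    [LieSuperalgebra K P] (M : GradedIdeal K P) :
    ∃ (f : LinearMap.ker M.extToBase →ₗ[K] H₂ K P)
      (δ : H₂ K M.Quot →ₗ[K] M.Coinv)
      (i : M.Coinv →ₗ[K] H₁ K P),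
      -- `f` sends the class of `∑ p ∧ m` in `P ∧ M` to the homology class of the cycle `∑ p ∧ m`
      (∀ (t : P ⊗[K] M.toSubmodule) (ht : M.toExt t ∈ LinearMap.ker M.extToBase)
        (hz : M.toWedge₂ t ∈ LinearMap.ker (d₂ K P)),
        f ⟨M.toExt t, ht⟩ = H₂.mk K (M.toWedge₂ t) hz) ∧
      -- `δ` sends the class of a cycle `∑ (x + M) ∧ (y + M)` to the class of `∑ [x, y]`
      (∀ (z : Wedge₂ K P) (hz : wedge₂Map M.mkHom z ∈ LinearMap.ker (d₂ K M.Quot))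
        (m : M.toSubmodule), (m : P) = -d₂ K P z →
        δ (H₂.mk K (wedge₂Map M.mkHom z) hz) = Submodule.Quotient.mk m) ∧
      -- `i` is induced by the inclusion of `M` in `P`
      (∀ m : M.toSubmodule, i (Submodule.Quotient.mk m) = H₁.mk K (m : P)) ∧
      -- all maps are even
      IsEven M.kerDeg (H₂.deg K P) f ∧
      IsEven (H₂.deg K P) (H₂.deg K M.Quot) (H₂.map M.mkHom) ∧
      IsEven (H₂.deg K M.Quot) M.coinvDeg δ ∧
      IsEven M.coinvDeg (H₁.deg K P) i ∧
      IsEven (H₁.deg K P) (H₁.deg K M.Quot) (H₁.map M.mkHom) ∧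
      -- the sequence is exact
      Function.Exact f (H₂.map M.mkHom) ∧
      Function.Exact (H₂.map M.mkHom) δ ∧
      Function.Exact δ i ∧
      Function.Exact i (H₁.map M.mkHom) ∧
      Function.Surjective (H₁.map M.mkHom) := by
  obtain ⟨f, hf⟩ := M.exists_kerToH₂
  obtain ⟨δ, hδ⟩ := M.exists_connecting
  refine ⟨f, δ, M.coinvToH₁, hf, hδ, M.coinvToH₁_mk, ?_, H₂.isEven_map _, ?_, ?_,
    H₁.isEven_map _, ?_, ?_, ?_, ?_, ?_⟩
  · rintro a ⟨q, hq⟩ hqa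
    obtain ⟨t, rfl⟩ := M.toExt_surjective q
    have hz := M.toExt_mem_ker_iff.1 hq
    rw [hf t hq hz]
    -- the degree of the class is read off in `Λ²(P) / d₃ Λ³(P)`
    have h := M.extToChain_mem hqa
    rw [Submodule.subtype_apply, M.extToChain_toExt] at h
    obtain ⟨w, hw, hwt⟩ := ChainQuot.mem_deg.1 h
    have hwt' : w - M.toWedge₂ t ∈ LinearMap.range (d₃ K P) := (Submodule.Quotient.eq _).1 hwt
    have hw' : w ∈ LinearMap.ker (d₂ K P) := by
      obtain ⟨s, hs⟩ := hwt'
      rw [LinearMap.mem_ker, ← sub_add_cancel w (M.toWedge₂ t), ← hs, map_add, d₂_d₃, zero_add]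
      exact hz
    exact H₂.mem_deg.2 ⟨w, hw', hw, (H₂.mk_eq_mk hw' hz).2 hwt'⟩
  · intro a q hq
    obtain ⟨w, hw, hwa, rfl⟩ := H₂.mem_deg.1 hq
    obtain ⟨z, hz, rfl⟩ := M.exists_wedge₂Deg_lift hwa
    rw [hδ z hw ⟨-d₂ K P z, neg_mem (M.d₂_mem_iff.2 hw)⟩ rfl]
    exact ⟨_, M.mem_deg.2 (neg_mem (d₂_mem_deg hz)), rfl⟩
  · rintro a _ ⟨m, hm, rfl⟩
    exact H₁.mem_deg.2 ⟨m, M.mem_deg.1 hm, rfl⟩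
  · intro q
    obtain ⟨z, hz, rfl⟩ := H₂.mk_surjective q
    rw [H₂.map_mk, H₂.mk_eq_zero]
    constructor
    · intro h
      obtain ⟨s, t, rfl⟩ := M.exists_eq_d₃_add_toWedge₂ h
      have ht : M.toWedge₂ t ∈ LinearMap.ker (d₂ K P) := by
        rwa [LinearMap.mem_ker, map_add, d₂_d₃, zero_add] at hz
      refine ⟨⟨M.toExt t, M.toExt_mem_ker_iff.2 ht⟩, ?_⟩
      rw [hf t _ ht, H₂.mk_eq_mk]
      exact ⟨-s, by rw [map_neg]; abel⟩
    · rintro ⟨⟨q, hq⟩, hqz⟩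
      obtain ⟨t, rfl⟩ := M.toExt_surjective q
      rw [hf t hq (M.toExt_mem_ker_iff.1 hq), H₂.mk_eq_mk] at hqz
      obtain ⟨s, hs⟩ := hqz
      have h := wedge₂Map_d₃_mem M.mkHom s
      rwa [hs, map_sub, M.wedge₂Map_toWedge₂, zero_sub, neg_mem_iff] at h
  · intro q
    obtain ⟨w, hw, rfl⟩ := H₂.mk_surjective q
    obtain ⟨z, rfl⟩ := M.wedge₂Map_mkHom_surjective w
    rw [hδ z hw ⟨-d₂ K P z, neg_mem (M.d₂_mem_iff.2 hw)⟩ rfl]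
    constructor
    · intro h
      have h' : -d₂ K P z ∈ brkSpan ⊤ M.toSubmodule :=
        Submodule.mem_comap.1 ((Submodule.Quotient.mk_eq_zero _).1 h)
      rw [neg_mem_iff, ← M.range_d₂_comp_toWedge₂] at h'
      obtain ⟨t, ht⟩ := h'
      -- correcting the lift `z` by elements `p ∧ m` makes it a cycle
      have hzt : z - M.toWedge₂ t ∈ LinearMap.ker (d₂ K P) := by
        rw [LinearMap.mem_ker, map_sub, sub_eq_zero]
        exact ht.symm
      refine ⟨H₂.mk K _ hzt, ?_⟩
      rw [H₂.map_mk, H₂.mk_eq_mk, map_sub, M.wedge₂Map_toWedge₂, sub_zero, sub_self]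
      exact zero_mem _
    · rintro ⟨q, hq⟩
      obtain ⟨y, hy, rfl⟩ := H₂.mk_surjective q
      rw [← hδ z hw ⟨-d₂ K P z, neg_mem (M.d₂_mem_iff.2 hw)⟩ rfl, ← hq, H₂.map_mk,
        hδ y _ 0 (by rw [LinearMap.mem_ker.1 hy]; simp)]
      rfl
  · intro q
    obtain ⟨m, rfl⟩ := Submodule.mkQ_surjective _ q
    change M.coinvToH₁ (Submodule.Quotient.mk m) = 0 ↔ Submodule.Quotient.mk m ∈ Set.range δ
    rw [M.coinvToH₁_mk, H₁.mk_eq_zero]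
    constructor
    · rintro ⟨z, hz⟩
      have hz' : d₂ K P (-z) ∈ M.toSubmodule := by
        rw [map_neg, hz]
        exact neg_mem m.2
      exact ⟨_, hδ (-z) (M.d₂_mem_iff.1 hz') m (by rw [map_neg, neg_neg, hz])⟩
    · rintro ⟨q, hq⟩
      obtain ⟨w, hw, rfl⟩ := H₂.mk_surjective q
      obtain ⟨z, rfl⟩ := M.wedge₂Map_mkHom_surjective w
      rw [hδ z hw ⟨-d₂ K P z, neg_mem (M.d₂_mem_iff.2 hw)⟩ rfl] at hq
      rw [← H₁.mk_eq_zero, ← M.coinvToH₁_mk, ← hq, M.coinvToH₁_mk, H₁.mk_eq_zero]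
      exact neg_mem ⟨z, rfl⟩
  · intro q
    obtain ⟨x, rfl⟩ := H₁.mk_surjective q
    rw [H₁.map_mk, H₁.mk_eq_zero]
    constructor
    · rintro ⟨w, hw⟩
      obtain ⟨z, rfl⟩ := M.wedge₂Map_mkHom_surjective w
      rw [d₂_wedge₂Map] at hw
      have hx : x - d₂ K P z ∈ M.toSubmodule := (Submodule.Quotient.eq _).1 hw.symm
      refine ⟨Submodule.Quotient.mk ⟨_, hx⟩, ?_⟩
      rw [M.coinvToH₁_mk, H₁.mk_eq_mk]
      exact ⟨-z, by rw [map_neg, sub_sub_cancel_left]⟩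
    · rintro ⟨c, hc⟩
      obtain ⟨m, rfl⟩ := Submodule.mkQ_surjective _ c
      have h : (m : P) - x ∈ LinearMap.range (d₂ K P) := H₁.mk_eq_mk.1 hc
      obtain ⟨z, hz⟩ := h
      refine ⟨wedge₂Map M.mkHom (-z), ?_⟩
      rw [d₂_wedge₂Map, map_neg, hz]
      refine (Submodule.Quotient.eq _).2 ?_
      rw [neg_sub, sub_sub_cancel_left]
      exact neg_mem m.2
  · intro q
    obtain ⟨y, rfl⟩ := H₁.mk_surjective q
    obtain ⟨x, rfl⟩ := M.toSubmodule.mkQ_surjective y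
    exact ⟨H₁.mk K x, rfl⟩
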